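/- Let $d\in\{1,2,3\}$, let $D\subset\mathbb R^d$ be a nonempty bounded domain (connected open set) with Lipschitz boundary, let $M\ge 2$, and let $E_1,\dots,E_M$ be nonempty connected relatively open subsets of $\partial D$ with $\overline{E_i}\cap\overline{E_j}=\varnothing$ for $i\ne j$. Let $\mathcal H=(H^1(D)\oplus\mathbb R^M)/\mathbb R$, where $\mathbb R$ is the line of the pairs $(c,(c,\dots,c))$, with the norm $$\|(v,V)\|_{\mathcal H}^2=\int_D|\nabla v|^2\,dx+\sum_{k=1}^M\int_{E_k}(v-V_k)^2\,dS ,$$ where $v$ stands for its trace on $\partial D$ in the surface integrals. Let $\Upsilon=(-1/2,1/2)^{\mathbb N}$ and let $\mathscr F$ be the set of finitely supported multi-indices $\nu\in\mathbb N_0^{\mathbb N}$; write $|\nu|=\sum_j\nu_j$, $x^\nu=\prod_j x_j^{\nu_j}$ (with $0^0=1$), $\binom{\nu}{m}=\prod_j\binom{\nu_j}{m_j}$, let $m\le\nu$ mean $m_j\le\nu_j$ for all $j$, and let $\partial^\nu=\prod_j\partial^{\nu_j}/\partial y_j^{\nu_j}$. Let $a:D\times\Upsilon\to\mathbb R$ be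 such that * $a(\cdot,y)\in L^\infty(D)$ for all $y\in\Upsilon$; * for every $x\in D$ the function $a(x,\cdot)$ has partial derivatives of all orders on $\Upsilon$ (independent of the order of differentiation), and there are constants $C_a,\sigma\ge1$ and a summable sequence $\rho=(\rho_j)$ of non-negative reals with $\|\partial^\nu a(\cdot,y)\|_{L^\infty(D)}\le C_a(|\nu|!)^\sigma\rho^\nu$ for all $\nu\in\mathscr F$ and $y\in\Upsilon$; * there are constants $0<a_{\min}\le a_{\max}<\infty$ with $a_{\min}\le a(x,y)\le a_{\max}$ for all $x\in D$ and $y\in\Upsilon$. Let $0<\varsigma_-\le z_m\le\varsigma_+<\infty$ for $m=1,\dots,M$, let $I\in\mathbb R^M$ with $\sum_m I_m=0$, and for every $y\in\Upsilon$ let $(u(\cdot,y),U(y))\in\mathcal H$ be the solution of $$\int_D a(\cdot,y)\nabla u(\cdot,y)\cdot\nabla v\,dx+\sum_{m=1}^M\frac1{z_m}\int_{E_m}(u(\cdot,y)-U_m(y))(v-V_m)\,dS=\sum_{m=1}^MI_mV_m\qquad\text{for all }(v,V)\in\mathcal H .$$ Then the map $y\mapsto(u(\cdot,y),U(y))$ has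 partial derivatives $\partial^\nu(u(\cdot,y),U(y))\in\mathcal H$ of all orders $\nu\in\mathscr F$ at all $y\in\Upsilon$ (limits of difference quotients in the norm of $\mathcal H$, independent of the order of differentiation), and for all $\nu\in\mathscr F\setminus\{0\}$ and $y\in\Upsilon$ $$\|\partial^\nu(u(\cdot,y),U(y))\|_{\mathcal H}\le\frac{C_a}{\min\{a_{\min},\varsigma_+^{-1}\}}\sum_{0\ne m\le\nu}\binom{\nu}{m}(|m|!)^\sigma\rho^m\,\|\partial^{\nu-m}(u(\cdot,y),U(y))\|_{\mathcal H}.$$ -/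

import Mathlib

open MeasureTheory Set Filter Topology
open scoped NNReal ContDiff InnerProductSpace

noncomputable section

namespace CEM

/-! ### Parameters, multi-indices and mixed partial derivatives -/

/-- The parameter set `(-1/2, 1/2)^ℕ`. -/
def paramBox : Set (ℕ → ℝ) := {y | ∀ j, y j ∈ Ioo (-(1 / 2) : ℝ) (1 / 2)}

/-- The partial derivative in the `j`-th coordinate of a function of infinitely many real
variables with values in a topological vector space. -/
def partialDeriv {F : Type*} [AddCommGroup F] [Module ℝ F] [TopologicalSpace F]
    (j : ℕ) (f : (ℕ → ℝ) → F) (y : ℕ → ℝ) : F :=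
  deriv (fun t : ℝ => f (Function.update y j t)) (y j)

/-- The mixed partial derivative of multi-index `ν`: the partial derivatives in the coordinates
`j`, each taken `ν j` times, composed in the order of the coordinates (the largest coordinate is
differentiated first). -/
def mixedPartial {F : Type*} [AddCommGroup F] [Module ℝ F] [TopologicalSpace F]
    (ν : ℕ →₀ ℕ) (f : (ℕ → ℝ) → F) : (ℕ → ℝ) → F :=
  ((Finsupp.toMultiset ν).sort (· ≤ ·)).foldr partialDeriv f

/-- `f` has partial derivatives of all orders at every point of the parameter set, and they do
not depend on the order of differentiation: every `∂^ν f` is differentiable in every coordinate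
`j`, with derivative `∂^(ν + e_j) f`. -/
def HasAllPartials {F : Type*} [AddCommGroup F] [Module ℝ F] [TopologicalSpace F]
    [ContinuousSMul ℝ F] (f : (ℕ → ℝ) → F) : Prop :=
  ∀ (ν : ℕ →₀ ℕ) (j : ℕ), ∀ y ∈ paramBox,
    HasDerivAt (fun t : ℝ => mixedPartial ν f (Function.update y j t))
      (mixedPartial (ν + Finsupp.single j 1) f y) (y j)

/-- The power `x ^ ν = ∏ j, x j ^ ν j`, with `0 ^ 0 = 1`. -/
def multiPow (x : ℕ → ℝ) (ν : ℕ →₀ ℕ) : ℝ := ∏ j ∈ ν.support, x j ^ ν j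

/-- The binomial coefficient of two multi-indices, for `m ≤ ν` (the factors outside the support
of `ν` are then equal to `1`). -/
def multiChoose (ν m : ℕ →₀ ℕ) : ℕ := ∏ j ∈ ν.support, (ν j).choose (m j)

/-! ### Lipschitz domains -/

/-- Near each boundary point and in suitable Cartesian coordinates, `D` is the region above the
graph of a Lipschitz function: `e` is the direction of the last coordinate axis, and the
hyperplane orthogonal to `e` carries the other coordinates. -/
def HasLipschitzBoundary {d : ℕ} (D : Set (EuclideanSpace ℝ (Fin d))) : Prop :=
  ∀ x₀ ∈ frontier D, ∃ (e : EuclideanSpace ℝ (Fin d)) (r : ℝ) (K : ℝ≥0)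
    (ψ : (ℝ ∙ e)ᗮ → ℝ), ‖e‖ = 1 ∧ 0 < r ∧ LipschitzWith K ψ ∧
      ∀ x ∈ Metric.ball x₀ r, x ∈ D ↔ ψ ((ℝ ∙ e)ᗮ.orthogonalProjectionOnto x) < ⟪e, x⟫_ℝ

/-- The physical domain and the electrodes: a nonempty connected bounded open set `D` with
Lipschitz boundary, and nonempty connected relatively open subsets of the boundary of `D` with
pairwise disjoint closures. -/
structure Geometry (d M : ℕ) where
  /-- the domain -/
  D : Set (EuclideanSpace ℝ (Fin d))
  isOpen_D : IsOpen D
  isConnected_D : IsConnected D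
  isBounded_D : Bornology.IsBounded D
  lipschitz_D : HasLipschitzBoundary D
  /-- the electrodes -/
  electrode : Fin M → Set (EuclideanSpace ℝ (Fin d))
  electrode_open : ∀ k, ∃ O : Set (EuclideanSpace ℝ (Fin d)),
    IsOpen O ∧ electrode k = O ∩ frontier D
  electrode_connected : ∀ k, IsConnected (electrode k)
  electrode_disjoint : ∀ i j, i ≠ j → Disjoint (closure (electrode i)) (closure (electrode j))

namespace Geometry

variable {d M : ℕ} (G : Geometry d M)

/-- Lebesgue measure on the domain. -/
def vol : Measure (EuclideanSpace ℝ (Fin d)) := volume.restrict G.D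

/-- Surface measure: the `(d-1)`-dimensional Hausdorff measure (normalized to agree with Lebesgue
measure in dimension `d-1`) on the boundary of the domain. -/
def surf : Measure (EuclideanSpace ℝ (Fin d)) :=
  (Measure.euclideanHausdorffMeasure (d - 1)).restrict (frontier G.D)

instance : IsFiniteMeasure G.vol :=
  ⟨by rw [vol, Measure.restrict_apply_univ]; exact G.isBounded_D.measure_lt_top⟩

theorem surf_local_finite (x₀ : EuclideanSpace ℝ (Fin d)) (hx₀ : x₀ ∈ frontier G.D) :
    ∃ r > 0, Measure.euclideanHausdorffMeasure (d - 1) (frontier G.D ∩ Metric.ball x₀ r) < ⊤ := by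
  obtain ⟨e, r, K, ψ, he, hr, hψ, hD⟩ := G.lipschitz_D x₀ hx₀
  refine ⟨r, hr, ?_⟩
  let V : Submodule ℝ (EuclideanSpace ℝ (Fin d)) := (ℝ ∙ e)ᗮ
  let P := (ℝ ∙ e)ᗮ.orthogonalProjectionOnto
  have he0 : e ≠ 0 := by rintro rfl; simp at he
  have hdim : Module.finrank ℝ V = d - 1 := by
    have h1 := (ℝ ∙ e).finrank_add_finrank_orthogonal
    rw [finrank_span_singleton he0, finrank_euclideanSpace_fin] at h1
    change Module.finrank ℝ (ℝ ∙ e)ᗮ = d - 1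
    omega
  have hlip : LipschitzWith (1 + K) (fun v : V => (v : EuclideanSpace ℝ (Fin d)) + ψ v • e) := by
    refine LipschitzWith.add ?_ ?_
    · exact LipschitzWith.of_dist_le_mul (fun x y => by simp [Subtype.dist_eq])
    · refine LipschitzWith.of_dist_le_mul (fun x y => ?_)
      rw [dist_eq_norm, ← sub_smul, norm_smul, he, mul_one]
      simpa [Real.dist_eq] using hψ.dist_le_mul x y
  have hsub : frontier G.D ∩ Metric.ball x₀ r ⊆
      (fun v : V => (v : EuclideanSpace ℝ (Fin d)) + ψ v • e) '' (P '' Metric.ball x₀ r) := by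
    rintro x ⟨hx, hxr⟩
    refine ⟨P x, mem_image_of_mem _ hxr, ?_⟩
    have hle : ⟪e, x⟫_ℝ ≤ ψ (P x) := by
      by_contra! hlt
      have hxD : x ∈ G.D := (hD x hxr).2 hlt
      rw [G.isOpen_D.frontier_eq] at hx
      exact hx.2 hxD
    have hge : ψ (P x) ≤ ⟪e, x⟫_ℝ := by
      have hcl : IsClosed {z | ψ (P z) ≤ ⟪e, z⟫_ℝ} :=
        isClosed_le (hψ.continuous.comp P.continuous) (continuous_const.inner continuous_id)
      have hmem : x ∈ closure (G.D ∩ Metric.ball x₀ r) := by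
        rw [inter_comm]
        exact Metric.isOpen_ball.inter_closure ⟨hxr, frontier_subset_closure hx⟩
      refine closure_minimal ?_ hcl hmem
      rintro z ⟨hz, hzr⟩
      exact ((hD z hzr).1 hz).le
    have heq := le_antisymm hge hle
    change (P x : EuclideanSpace ℝ (Fin d)) + ψ (P x) • e = x
    rw [heq]
    have h2 := (ℝ ∙ e).starProjection_add_starProjection_orthogonal x
    rw [Submodule.starProjection_unit_singleton ℝ he] at h2
    rw [add_comm]
    exact h2
  refine (measure_mono hsub).trans_lt ?_
  have hfin : (Measure.hausdorffMeasure ((d - 1 : ℕ) : ℝ) : Measure V) (P '' Metric.ball x₀ r)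
      < ⊤ := by
    rw [← hdim]
    exact (P.lipschitz.isBounded_image Metric.isBounded_ball).measure_lt_top
  have hfin2 := (hlip.hausdorffMeasure_image_le (d := ((d - 1 : ℕ) : ℝ)) (by positivity)
    (P '' Metric.ball x₀ r)).trans_lt
      (ENNReal.mul_lt_top (ENNReal.rpow_lt_top_of_nonneg (by positivity) (by simp)) hfin)
  rw [Measure.euclideanHausdorffMeasure_def, Measure.smul_apply, ENNReal.smul_def]
  exact ENNReal.mul_lt_top (by simp) hfin2

instance : IsFiniteMeasure G.surf := by
  have hcomp : IsCompact (frontier G.D) :=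
    Metric.isCompact_of_isClosed_isBounded isClosed_frontier
      (G.isBounded_D.closure.subset frontier_subset_closure)
  refine ⟨?_⟩
  rw [surf, Measure.restrict_apply_univ]
  refine hcomp.induction_on
    (p := fun s => Measure.euclideanHausdorffMeasure (d - 1) s < ⊤) (by simp)
    (fun s t hst ht => (measure_mono hst).trans_lt ht)
    (fun s t hs ht => (measure_union_le s t).trans_lt (ENNReal.add_lt_top.2 ⟨hs, ht⟩)) ?_
  intro x hx
  obtain ⟨r, hr, h⟩ := G.surf_local_finite x hx
  exact ⟨_, inter_mem self_mem_nhdsWithin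
    (mem_nhdsWithin_of_mem_nhds (Metric.ball_mem_nhds x hr)), h⟩

/-! ### The space `H¹(D)` and the trace -/

/-- `g` is the weak gradient of `v` on the domain. -/
def HasWeakGradient (v : EuclideanSpace ℝ (Fin d) → ℝ)
    (g : EuclideanSpace ℝ (Fin d) → EuclideanSpace ℝ (Fin d)) : Prop :=
  ∀ φ : EuclideanSpace ℝ (Fin d) → ℝ, ContDiff ℝ ∞ φ → HasCompactSupport φ →
    tsupport φ ⊆ G.D → ∀ i : Fin d,
      ∫ x in G.D, v x * fderiv ℝ φ x (EuclideanSpace.single i 1) = -∫ x in G.D, g x i * φ x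

theorem memLp_coord {g : EuclideanSpace ℝ (Fin d) → EuclideanSpace ℝ (Fin d)}
    {μ : Measure (EuclideanSpace ℝ (Fin d))} (hg : MemLp g 2 μ) (i : Fin d) :
    MemLp (fun x => g x i) 2 μ :=
  (EuclideanSpace.proj (𝕜 := ℝ) i).comp_memLp' hg

theorem integrable_mul_test {v φ : EuclideanSpace ℝ (Fin d) → ℝ} (hv : MemLp v 2 G.vol)
    (hφ : Continuous φ) (hc : HasCompactSupport φ) :
    Integrable (fun x => v x * φ x) (volume.restrict G.D) :=
  MemLp.integrable_mul (p := 2) (q := 2) hv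
    ((hφ.memLp_of_hasCompactSupport hc : MemLp φ 2 volume).restrict G.D)

theorem integrable_mul_test_fderiv {v φ : EuclideanSpace ℝ (Fin d) → ℝ} (hv : MemLp v 2 G.vol)
    (hφ : ContDiff ℝ ∞ φ) (hc : HasCompactSupport φ) (e : EuclideanSpace ℝ (Fin d)) :
    Integrable (fun x => v x * fderiv ℝ φ x e) (volume.restrict G.D) :=
  G.integrable_mul_test hv ((hφ.continuous_fderiv (by simp)).clm_apply continuous_const)
    (hc.fderiv_apply ℝ e)

/-- The Sobolev space `H¹(D)`: functions in `L²(D)` with a weak gradient in `L²(D)`; an element is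
stored together with its weak gradient (which it determines). -/
def H1 : Submodule ℝ (Lp ℝ 2 G.vol × Lp (EuclideanSpace ℝ (Fin d)) 2 G.vol) where
  carrier := {p | G.HasWeakGradient p.1 p.2}
  zero_mem' := by
    intro φ _ _ _ i
    have h1 : ((0 : Lp ℝ 2 G.vol) : EuclideanSpace ℝ (Fin d) → ℝ) =ᵐ[volume.restrict G.D] 0 :=
      Lp.coeFn_zero _ _ _
    have h2 : ((0 : Lp (EuclideanSpace ℝ (Fin d)) 2 G.vol) : _ → EuclideanSpace ℝ (Fin d))
        =ᵐ[volume.restrict G.D] 0 := Lp.coeFn_zero _ _ _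
    have e1 : ∫ x in G.D, ((0 : Lp ℝ 2 G.vol) : EuclideanSpace ℝ (Fin d) → ℝ) x *
        fderiv ℝ φ x (EuclideanSpace.single i 1) = 0 :=
      integral_eq_zero_of_ae (by filter_upwards [h1] with x hx; rw [hx]; simp)
    have e2 : ∫ x in G.D, ((0 : Lp (EuclideanSpace ℝ (Fin d)) 2 G.vol) :
        _ → EuclideanSpace ℝ (Fin d)) x i * φ x = 0 :=
      integral_eq_zero_of_ae (by filter_upwards [h2] with x hx; rw [hx]; simp)
    exact e1.trans (by rw [← neg_zero]; exact congrArg _ e2.symm)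
  add_mem' := by
    intro p q hp hq φ hφ hc hs i
    have h1 : (((p.1 + q.1 : Lp ℝ 2 G.vol)) : EuclideanSpace ℝ (Fin d) → ℝ)
        =ᵐ[volume.restrict G.D] p.1 + q.1 := Lp.coeFn_add _ _
    have h2 : (((p.2 + q.2 : Lp (EuclideanSpace ℝ (Fin d)) 2 G.vol)) :
        _ → EuclideanSpace ℝ (Fin d)) =ᵐ[volume.restrict G.D] p.2 + q.2 := Lp.coeFn_add _ _
    change ∫ x in G.D, (p.1 + q.1 : Lp ℝ 2 G.vol) x * _ =
      -∫ x in G.D, (p.2 + q.2 : Lp (EuclideanSpace ℝ (Fin d)) 2 G.vol) x i * φ x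
    have e1 : ∫ x in G.D, (p.1 + q.1 : Lp ℝ 2 G.vol) x *
        fderiv ℝ φ x (EuclideanSpace.single i 1) =
        (∫ x in G.D, p.1 x * fderiv ℝ φ x (EuclideanSpace.single i 1)) +
          ∫ x in G.D, q.1 x * fderiv ℝ φ x (EuclideanSpace.single i 1) := by
      rw [← integral_add (G.integrable_mul_test_fderiv (Lp.memLp p.1) hφ hc _)
        (G.integrable_mul_test_fderiv (Lp.memLp q.1) hφ hc _)]
      exact integral_congr_ae (by filter_upwards [h1] with x hx; rw [hx]; simp [add_mul])
    have e2 : ∫ x in G.D, (p.2 + q.2 : Lp (EuclideanSpace ℝ (Fin d)) 2 G.vol) x i * φ x =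
        (∫ x in G.D, p.2 x i * φ x) + ∫ x in G.D, q.2 x i * φ x := by
      rw [← integral_add
        (G.integrable_mul_test (memLp_coord (Lp.memLp p.2) i) hφ.continuous hc)
        (G.integrable_mul_test (memLp_coord (Lp.memLp q.2) i) hφ.continuous hc)]
      exact integral_congr_ae (by filter_upwards [h2] with x hx; rw [hx]; simp [add_mul])
    rw [e1, e2, hp φ hφ hc hs i, hq φ hφ hc hs i]
    ring
  smul_mem' := by
    intro c p hp φ hφ hc hs i
    have h1 : ((c • p.1 : Lp ℝ 2 G.vol) : EuclideanSpace ℝ (Fin d) → ℝ)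
        =ᵐ[volume.restrict G.D] c • p.1 := Lp.coeFn_smul _ _
    have h2 : ((c • p.2 : Lp (EuclideanSpace ℝ (Fin d)) 2 G.vol) :
        _ → EuclideanSpace ℝ (Fin d)) =ᵐ[volume.restrict G.D] c • p.2 := Lp.coeFn_smul _ _
    change ∫ x in G.D, (c • p.1 : Lp ℝ 2 G.vol) x * _ =
      -∫ x in G.D, (c • p.2 : Lp (EuclideanSpace ℝ (Fin d)) 2 G.vol) x i * φ x
    have e1 : ∫ x in G.D, (c • p.1 : Lp ℝ 2 G.vol) x *
        fderiv ℝ φ x (EuclideanSpace.single i 1) =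
        c * ∫ x in G.D, p.1 x * fderiv ℝ φ x (EuclideanSpace.single i 1) := by
      rw [← integral_const_mul]
      exact integral_congr_ae (by filter_upwards [h1] with x hx; rw [hx]; simp [mul_assoc])
    have e2 : ∫ x in G.D, (c • p.2 : Lp (EuclideanSpace ℝ (Fin d)) 2 G.vol) x i * φ x =
        c * ∫ x in G.D, p.2 x i * φ x := by
      rw [← integral_const_mul]
      exact integral_congr_ae (by filter_upwards [h2] with x hx; rw [hx]; simp [mul_assoc])
    rw [e1, e2, hp φ hφ hc hs i]
    ring

instance : AddCommGroup G.H1 := inferInstance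

/-- The triples (restriction to `D`, gradient on `D`, restriction to the boundary) of the smooth
functions on the whole space. -/
def smoothGraph : Submodule ℝ (Lp ℝ 2 G.vol × Lp (EuclideanSpace ℝ (Fin d)) 2 G.vol ×
    Lp ℝ 2 G.surf) where
  carrier := {p | ∃ φ : EuclideanSpace ℝ (Fin d) → ℝ, ContDiff ℝ ∞ φ ∧
    p.1 =ᵐ[G.vol] φ ∧ p.2.1 =ᵐ[G.vol] gradient φ ∧ p.2.2 =ᵐ[G.surf] φ}
  zero_mem' := by
    refine ⟨0, contDiff_const, Lp.coeFn_zero _ _ _, ?_, Lp.coeFn_zero _ _ _⟩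
    filter_upwards [Lp.coeFn_zero (EuclideanSpace ℝ (Fin d)) 2 G.vol] with x hx
    have : gradient (0 : EuclideanSpace ℝ (Fin d) → ℝ) x = 0 := gradient_const x 0
    rw [this]
    exact hx
  add_mem' := by
    rintro p q ⟨φ, hφ, h1, h2, h3⟩ ⟨χ, hχ, k1, k2, k3⟩
    refine ⟨φ + χ, hφ.add hχ, (Lp.coeFn_add p.1 q.1).trans (h1.add k1), ?_,
      (Lp.coeFn_add p.2.2 q.2.2).trans (h3.add k3)⟩
    refine (Lp.coeFn_add p.2.1 q.2.1).trans ((h2.add k2).trans (.of_forall fun x => ?_))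
    have hf : fderiv ℝ (φ + χ) x = fderiv ℝ φ x + fderiv ℝ χ x :=
      fderiv_add (hφ.differentiable (by simp) x) (hχ.differentiable (by simp) x)
    simp [gradient, hf]
  smul_mem' := by
    rintro c p ⟨φ, hφ, h1, h2, h3⟩
    refine ⟨c • φ, contDiff_const.smul hφ, (Lp.coeFn_smul c p.1).trans (h1.const_smul c), ?_,
      (Lp.coeFn_smul c p.2.2).trans (h3.const_smul c)⟩
    refine (Lp.coeFn_smul c p.2.1).trans ((h2.const_smul c).trans (.of_forall fun x => ?_))
    have hf : fderiv ℝ (c • φ) x = c • fderiv ℝ φ x :=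
      fderiv_const_smul (hφ.differentiable (by simp) x) c
    simp [gradient, hf]

/-- `τ ∈ L²(∂D)` is the trace of `v ∈ H¹(D)`: the trace is the continuous extension to `H¹(D)`
of the restriction to `∂D` of functions smooth up to the boundary, that is, there are smooth
functions that converge to `v` in `H¹(D)` and whose restrictions to `∂D` converge to `τ`. -/
def IsTrace (v : G.H1) (τ : Lp ℝ 2 G.surf) : Prop :=
  (v.1.1, v.1.2, τ) ∈ closure (G.smoothGraph : Set (Lp ℝ 2 G.vol ×
    Lp (EuclideanSpace ℝ (Fin d)) 2 G.vol × Lp ℝ 2 G.surf))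

/-- The graph of the trace operator `H¹(D) → L²(∂D)`: the functions of `H¹(D)`, each with its trace
on `∂D` (as the boundary is Lipschitz, every function of `H¹(D)` has exactly one trace). -/
def H1Trace : Submodule ℝ (G.H1 × Lp ℝ 2 G.surf) where
  carrier := {p | G.IsTrace p.1 p.2}
  zero_mem' := G.smoothGraph.topologicalClosure.zero_mem
  add_mem' := fun hp hq => G.smoothGraph.topologicalClosure.add_mem hp hq
  smul_mem' := fun c _ hp => G.smoothGraph.topologicalClosure.smul_mem c hp

instance : AddCommGroup G.H1Trace := inferInstance

/-! ### The Hilbert space `𝓗` -/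

/-- The direct sum of `H¹(D)` (functions with their traces) and `ℝ^M`. -/
abbrev PreH : Type := G.H1Trace × (Fin M → ℝ)

theorem integral_fderiv_test {φ : EuclideanSpace ℝ (Fin d) → ℝ} (hφ : ContDiff ℝ ∞ φ)
    (hc : HasCompactSupport φ) (hs : tsupport φ ⊆ G.D) (e : EuclideanSpace ℝ (Fin d)) :
    ∫ x in G.D, fderiv ℝ φ x e = 0 := by
  have hcont : Continuous fun x => fderiv ℝ φ x e :=
    (hφ.continuous_fderiv (by simp)).clm_apply continuous_const
  have hsupp : Function.support (fun x => fderiv ℝ φ x e) ⊆ G.D := by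
    intro x hx
    refine hs (support_fderiv_subset ℝ (f := φ) ?_)
    intro h
    exact hx (by simp [h])
  rw [setIntegral_eq_integral_of_forall_compl_eq_zero
    (fun x hx => by by_contra h; exact hx (hsupp h))]
  have := integral_mul_fderiv_eq_neg_fderiv_mul_of_integrable (μ := volume)
    (f := fun _ : EuclideanSpace ℝ (Fin d) => (1 : ℝ)) (g := φ) (v := e)
    (by simp) (by simpa using hcont.integrable_of_hasCompactSupport (hc.fderiv_apply ℝ e))
    (by simpa using hφ.continuous.integrable_of_hasCompactSupport hc)
    (fun _ _ => by fun_prop) (fun x _ => hφ.differentiable (by simp) x)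
  simpa using this

/-- The constant function `1`, with its trace `1`. -/
def oneH1 : G.H1Trace :=
  ⟨(⟨(Lp.const 2 G.vol 1, 0), by
      intro φ hφ hc hs i
      have h1 : (Lp.const 2 G.vol (1 : ℝ) : EuclideanSpace ℝ (Fin d) → ℝ)
          =ᵐ[volume.restrict G.D] Function.const _ 1 := Lp.coeFn_const 2 G.vol 1
      have h2 : ((0 : Lp (EuclideanSpace ℝ (Fin d)) 2 G.vol) : _ → EuclideanSpace ℝ (Fin d))
          =ᵐ[volume.restrict G.D] 0 := Lp.coeFn_zero _ _ _
      have e1 : ∫ x in G.D, (Lp.const 2 G.vol (1 : ℝ)) x *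
          fderiv ℝ φ x (EuclideanSpace.single i 1) = 0 := by
        rw [← G.integral_fderiv_test hφ hc hs (EuclideanSpace.single i 1)]
        exact integral_congr_ae (by filter_upwards [h1] with x hx; rw [hx]; simp)
      have e2 : ∫ x in G.D, ((0 : Lp (EuclideanSpace ℝ (Fin d)) 2 G.vol) :
          _ → EuclideanSpace ℝ (Fin d)) x i * φ x = 0 :=
        integral_eq_zero_of_ae (by filter_upwards [h2] with x hx; rw [hx]; simp)
      exact e1.trans (by rw [← neg_zero]; exact congrArg _ e2.symm)⟩, Lp.const 2 G.surf 1), by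
    refine subset_closure ⟨fun _ => 1, contDiff_const, Lp.coeFn_const _ _ _, ?_,
      Lp.coeFn_const _ _ _⟩
    filter_upwards [Lp.coeFn_zero (EuclideanSpace ℝ (Fin d)) 2 G.vol] with x hx
    exact hx.trans (gradient_const x (1 : ℝ)).symm⟩

/-- The line of the pairs `(c, (c, …, c))`. -/
def constants : Submodule ℝ G.PreH := ℝ ∙ ((G.oneH1, fun _ => 1) : G.PreH)

/-- The vector space `𝓗 = (H¹(D) ⊕ ℝ^M) / ℝ`; its norm is given below. -/

def H : Type := G.PreH ⧸ G.constants

instance : AddCommGroup G.H :=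
  inferInstanceAs (AddCommGroup (G.PreH ⧸ G.constants))

instance : Module ℝ G.H :=
  inferInstanceAs (Module ℝ (G.PreH ⧸ G.constants))

/-- The class in `𝓗` of a pair `(v, V)`. -/
def mkH : G.PreH →ₗ[ℝ] G.H := G.constants.mkQ

/-- The gradient `∇v` of `(v, V)`. -/
def preGrad : G.PreH →ₗ[ℝ] Lp (EuclideanSpace ℝ (Fin d)) 2 G.vol :=
  LinearMap.snd ℝ _ _ ∘ₗ G.H1.subtype ∘ₗ LinearMap.fst ℝ _ _ ∘ₗ G.H1Trace.subtype ∘ₗ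
    LinearMap.fst ℝ _ _

/-- The difference `v - V k` on the `k`-th electrode, where `v` stands for its trace. -/
def preJump (k : Fin M) : G.PreH →ₗ[ℝ] Lp ℝ 2 (G.surf.restrict (G.electrode k)) :=
  (LpToLpRestrictCLM (EuclideanSpace ℝ (Fin d)) ℝ ℝ G.surf 2 (G.electrode k)).toLinearMap ∘ₗ
      LinearMap.snd ℝ _ _ ∘ₗ G.H1Trace.subtype ∘ₗ LinearMap.fst ℝ _ _ -
    Lp.constₗ 2 (G.surf.restrict (G.electrode k)) ℝ ∘ₗ LinearMap.proj k ∘ₗ LinearMap.snd ℝ _ _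

theorem preJump_coeFn (k : Fin M) (p : G.PreH) :
    G.preJump k p =ᵐ[G.surf.restrict (G.electrode k)] fun x => p.1.1.2 x - p.2 k := by
  refine (Lp.coeFn_sub _ _).trans ?_
  filter_upwards [LpToLpRestrictCLM_coeFn ℝ (G.electrode k) p.1.1.2 (p := 2) (μ := G.surf),
    Lp.coeFn_const 2 (G.surf.restrict (G.electrode k)) (p.2 k)] with x h1 h2
  exact congrArg₂ (· - ·) h1 h2

theorem preGrad_one : G.preGrad (G.oneH1, fun _ => 1) = 0 := rfl

theorem preJump_one (k : Fin M) : G.preJump k (G.oneH1, fun _ => 1) = 0 := by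
  refine Lp.ext ?_
  filter_upwards [G.preJump_coeFn k (G.oneH1, fun _ => 1), Lp.coeFn_zero ℝ 2
    (G.surf.restrict (G.electrode k)), ae_restrict_of_ae (Lp.coeFn_const 2 G.surf (1 : ℝ))]
    with x h1 h2 h3
  rw [h1, h2]
  change (Lp.const 2 G.surf (1 : ℝ)) x - 1 = 0
  rw [h3]
  simp

/-- The gradient, on `𝓗`. -/
def grad : G.H →ₗ[ℝ] Lp (EuclideanSpace ℝ (Fin d)) 2 G.vol :=
  Submodule.liftQSpanSingleton _ G.preGrad G.preGrad_one

/-- The difference `v - V k` on the `k`-th electrode, on `𝓗`. -/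
def jump (k : Fin M) : G.H →ₗ[ℝ] Lp ℝ 2 (G.surf.restrict (G.electrode k)) :=
  Submodule.liftQSpanSingleton _ (G.preJump k) (G.preJump_one k)

theorem grad_mkH (p : G.PreH) : G.grad (G.mkH p) = p.1.1.1.1.2 := rfl

theorem jump_mkH (k : Fin M) (p : G.PreH) :
    G.jump k (G.mkH p) =ᵐ[G.surf.restrict (G.electrode k)] fun x => p.1.1.2 x - p.2 k :=
  G.preJump_coeFn k p

/-- The gradient and the electrode differences together; the norm of `𝓗` is the norm of their
tuple in the `L²` direct sum. -/
def energyMap : G.H →ₗ[ℝ] WithLp 2 (Lp (EuclideanSpace ℝ (Fin d)) 2 G.vol ×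
    PiLp 2 (fun k : Fin M => Lp ℝ 2 (G.surf.restrict (G.electrode k)))) :=
  (WithLp.linearEquiv 2 ℝ _).symm.toLinearMap ∘ₗ
    LinearMap.prod G.grad ((WithLp.linearEquiv 2 ℝ _).symm.toLinearMap ∘ₗ LinearMap.pi G.jump)

instance : SeminormedAddCommGroup G.H := SeminormedAddCommGroup.induced _ _ G.energyMap

instance : NormedSpace ℝ G.H := NormedSpace.induced ℝ _ _ G.energyMap

theorem norm_sq_Lp_two {F : Type*} [NormedAddCommGroup F] [InnerProductSpace ℝ F]
    {μ : Measure (EuclideanSpace ℝ (Fin d))} (f : Lp F 2 μ) : ‖f‖ ^ 2 = ∫ x, ‖f x‖ ^ 2 ∂μ := by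
  rw [← real_inner_self_eq_norm_sq, L2.inner_def]
  simp

/-- The defining formula of the norm of `𝓗`. -/
theorem norm_sq_H (q : G.H) :
    ‖q‖ ^ 2 = (∫ x in G.D, ‖G.grad q x‖ ^ 2) +
      ∑ k, ∫ x in G.electrode k, (G.jump k q x) ^ 2 ∂G.surf := by
  have h : ‖q‖ = ‖G.energyMap q‖ := rfl
  rw [h, WithLp.prod_norm_sq_eq_of_L2, PiLp.norm_sq_eq_of_L2]
  change ‖G.grad q‖ ^ 2 + ∑ k, ‖G.jump k q‖ ^ 2 = _
  rw [norm_sq_Lp_two]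
  simp_rw [norm_sq_Lp_two, Real.norm_eq_abs, sq_abs]
  rfl

/-! ### The parametric complete electrode model -/

/-- The bilinear form of the complete electrode model with conductivity `a` and contact
impedances `z`. -/
def bilin (a : EuclideanSpace ℝ (Fin d) → ℝ) (z : Fin M → ℝ) (w v : G.H) : ℝ :=
  (∫ x in G.D, a x * ⟪G.grad w x, G.grad v x⟫_ℝ) +
    ∑ m, 1 / z m * ∫ x in G.electrode m, G.jump m w x * G.jump m v x ∂G.surf

/-- `w` solves the variational problem with current pattern `I`: `B(w, (v, V)) = ∑ m, I m * V m`
for all `(v, V)`. -/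
def IsSolution (a : EuclideanSpace ℝ (Fin d) → ℝ) (z I : Fin M → ℝ) (w : G.H) : Prop :=
  ∀ p : G.PreH, G.bilin a z w (G.mkH p) = ∑ m, I m * p.2 m

/-- The assumptions on the parametric conductivity: `a(·, y)` is essentially bounded, the partial
derivatives with respect to `y` satisfy Gevrey bounds in `L^∞(D)`, and `a` is bounded from above
and below by positive constants. -/
structure Conductivity (a : EuclideanSpace ℝ (Fin d) → (ℕ → ℝ) → ℝ) (C σ : ℝ) (ρ : ℕ → ℝ)
    (amin amax : ℝ) : Prop where
  memLp : ∀ y ∈ paramBox, MemLp (fun x => a x y) ⊤ G.vol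
  one_le_C : 1 ≤ C
  one_le_σ : 1 ≤ σ
  ρ_nonneg : ∀ j, 0 ≤ ρ j
  ρ_summable : Summable ρ
  partials : ∀ x ∈ G.D, HasAllPartials (a x)
  gevrey : ∀ (ν : ℕ →₀ ℕ), ∀ y ∈ paramBox,
    eLpNorm (fun x => mixedPartial ν (a x) y) ⊤ G.vol ≤
      ENNReal.ofReal (C * (Nat.factorial ν.degree : ℝ) ^ σ * multiPow ρ ν)
  amin_pos : 0 < amin
  bounds : ∀ x ∈ G.D, ∀ y ∈ paramBox, amin ≤ a x y ∧ a x y ≤ amax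

end Geometry

end CEM

end

noncomputable section

namespace CEM

/-! ### Multi-indices -/

/-! The variational problem is an equation A(y)w(y) = f in a Hilbert space, where A(y) is coercive
with constant c = min(a_min, 1/ς₊), depends on y only through the conductivity, and f does not
depend on y. If A is smooth in y, so is its inverse, hence so is w. Applying ∂^ν to the equation
gives the Leibniz identity ∑_{m ≤ ν} binom(ν, m) A_m w_{ν-m} = 0 for ν ≠ 0, with A_m = ∂^m A.
Isolating the term m = 0 and using c‖w_ν‖ ≤ ‖A_0 w_ν‖ yields the estimate. For m ≠ 0 the electrode
terms have disappeared from A_m, so its norm is at most that of ∂^m a in L^∞(D), which the Gevrey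
hypothesis bounds.

Three points need work.

Existence of the derivatives. The candidates w_ν are defined by the Leibniz recursion
(`leibnizSolution`), and an induction on |ν| shows that ∂_j w_ν = w_{ν+e_j}
(`hasDerivAt_leibnizSolution`). Its combinatorial core is Pascal's rule
(`sum_multiChoose_add_single`). Independence of the order of differentiation follows, since the
derivatives are indexed by multi-indices.

Smoothness of y ↦ a(·, y) into L^∞(D), although only pointwise derivatives are given. The Gevrey
bound at ν + 2e_j controls a second order Taylor remainder uniformly in x (`hasDerivAt_coeff`).

Completeness of 𝓗, which Lax–Milgram requires. The norm of 𝓗 is pulled back along the linear map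
`energyMap` into an L² space, and its range is shown to be closed (`isClosed_range_energyMap`). This
rests on a Poincaré inequality and a trace inequality on a Lipschitz domain, proved for smooth
functions and passed to the closure. The operator equation is then solved on this range, after
compressing the operators to it (`hasAllPartials_of_isClosed_range_of_form`). -/

theorem multiChoose_eq_prod {ν m : ℕ →₀ ℕ} (hm : m ≤ ν) {s : Finset ℕ} (hs : ν.support ⊆ s) :
    multiChoose ν m = ∏ i ∈ s, (ν i).choose (m i) := by
  refine Finset.prod_subset hs fun i _ hi => ?_
  have h0 : ν i = 0 := by simpa using hi
  have h1 : m i = 0 := Nat.le_zero.1 (h0 ▸ hm i)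
  rw [h0, h1, Nat.choose_zero_right]

theorem multiChoose_zero_right (ν : ℕ →₀ ℕ) : multiChoose ν 0 = 1 := by
  simp [multiChoose]

/-- Pascal's rule in the coordinate `j`; all other factors agree. The first guard is needed because
`multiChoose ν m` runs over the support of `ν` only: if `ν j = 0` and `m j = 1`, it misses the
vanishing factor. The second excludes truncated subtraction. -/
theorem multiChoose_add_single {ν m : ℕ →₀ ℕ} {j : ℕ} (hm : m ≤ ν + Finsupp.single j 1) :
    multiChoose (ν + Finsupp.single j 1) m = (if m ≤ ν then multiChoose ν m else 0) +
      if Finsupp.single j 1 ≤ m then multiChoose ν (m - Finsupp.single j 1) else 0 := by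
  classical
  set e : ℕ →₀ ℕ := Finsupp.single j 1 with he
  have hej : e j = 1 := by simp [he]
  have hei : ∀ i, i ≠ j → e i = 0 := fun i hi => by simp [he, hi.symm]
  set s : Finset ℕ := (ν + e).support
  have hjs : j ∈ s := by simp [s, hej]
  have hνs : ν.support ⊆ s := by
    intro i hi
    have : ν i ≠ 0 := by simpa using hi
    simp only [s, Finsupp.mem_support_iff, Finsupp.add_apply]
    omega
  set Q := ∏ i ∈ s.erase j, (ν i).choose (m i) with hQ
  have key1 : multiChoose (ν + e) m = (ν j + 1).choose (m j) * Q := by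
    rw [multiChoose_eq_prod hm subset_rfl, ← Finset.mul_prod_erase _ _ hjs, hQ]
    congr 1
    · simp [hej]
    · refine Finset.prod_congr rfl fun i hi => ?_
      simp [hei i (Finset.ne_of_mem_erase hi)]
  have key2 : (if m ≤ ν then multiChoose ν m else 0) = (ν j).choose (m j) * Q := by
    split_ifs with h
    · rw [multiChoose_eq_prod h hνs, ← Finset.mul_prod_erase _ _ hjs]
    -- Since `m ≤ ν + e`, the inequality `m ≤ ν` can fail only in the coordinate `j`.
    · have : ν j < m j := by
        by_contra! hle
        refine h fun i => ?_
        by_cases hi : i = j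
        · exact hi ▸ hle
        · simpa [hei i hi] using hm i
      rw [Nat.choose_eq_zero_of_lt this, zero_mul]
  rw [key1, key2]
  have hle : e ≤ m ↔ 1 ≤ m j := by simp [he]
  split_ifs with h
  · have hm' : m - e ≤ ν := tsub_le_iff_right.2 hm
    rw [multiChoose_eq_prod hm' hνs, ← Finset.mul_prod_erase _ _ hjs]
    have hQ' : ∏ i ∈ s.erase j, (ν i).choose ((m - e) i) = Q := by
      refine Finset.prod_congr rfl fun i hi => ?_
      simp [hei i (Finset.ne_of_mem_erase hi)]
    rw [hQ', Finsupp.tsub_apply, hej]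
    obtain ⟨k, hk⟩ := Nat.exists_eq_add_of_le' (hle.1 h)
    rw [hk, Nat.choose_succ_succ, Nat.add_sub_cancel]
    ring
  · have h0 : m j = 0 := by
      by_contra h0
      exact h (hle.2 (Nat.one_le_iff_ne_zero.2 h0))
    simp [h0]

/-- Pascal's rule, summed. -/
theorem sum_multiChoose_add_single {E : Type*} [AddCommGroup E] [Module ℝ E]
    (F : (ℕ →₀ ℕ) → (ℕ →₀ ℕ) → E) (ν : ℕ →₀ ℕ) (j : ℕ) :
    ∑ m ∈ Finset.Iic (ν + Finsupp.single j 1),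
        (multiChoose (ν + Finsupp.single j 1) m : ℝ) • F m (ν + Finsupp.single j 1 - m) =
      ∑ m ∈ Finset.Iic ν, (multiChoose ν m : ℝ) •
        (F (m + Finsupp.single j 1) (ν - m) + F m (ν - m + Finsupp.single j 1)) := by
  classical
  set e : ℕ →₀ ℕ := Finsupp.single j 1 with he
  have h1 : ∀ m ∈ Finset.Iic (ν + e), (multiChoose (ν + e) m : ℝ) • F m (ν + e - m) =
      (if m ≤ ν then (multiChoose ν m : ℝ) • F m (ν + e - m) else 0) +
      (if e ≤ m then (multiChoose ν (m - e) : ℝ) • F m (ν + e - m) else 0) := by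
    intro m hm
    rw [multiChoose_add_single (Finset.mem_Iic.1 hm)]
    push_cast
    simp only [add_smul, ite_smul, zero_smul, ← he]
  rw [Finset.sum_congr rfl h1, Finset.sum_add_distrib]
  simp_rw [smul_add]
  rw [Finset.sum_add_distrib, add_comm]
  congr 1
  · rw [← Finset.sum_filter]
    refine Finset.sum_bij' (fun m _ => m - e) (fun m _ => m + e) ?_ ?_ ?_ ?_ ?_
    · intro m hm
      simp only [Finset.mem_filter, Finset.mem_Iic] at hm ⊢
      exact tsub_le_iff_right.2 hm.1
    · intro m hm
      simp only [Finset.mem_filter, Finset.mem_Iic] at hm ⊢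
      exact ⟨add_le_add_left hm e, le_add_self⟩
    · intro m hm
      simp only [Finset.mem_filter, Finset.mem_Iic] at hm
      exact tsub_add_cancel_of_le hm.2
    · intro m hm
      exact add_tsub_cancel_right m e
    · intro m hm
      simp only [Finset.mem_filter, Finset.mem_Iic] at hm
      have h2 : ν + e - m = ν - (m - e) := by
        conv_lhs => rw [← tsub_add_cancel_of_le hm.2]
        exact add_tsub_add_eq_tsub_right _ _ _
      rw [h2, tsub_add_cancel_of_le hm.2]
  · rw [← Finset.sum_filter]
    refine Finset.sum_congr ?_ fun m hm => ?_
    · ext m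
      simp only [Finset.mem_filter, Finset.mem_Iic]
      exact ⟨fun h => h.2, fun h => ⟨h.trans le_self_add, h⟩⟩
    · rw [tsub_add_eq_add_tsub (Finset.mem_Iic.1 hm)]

theorem degree_tsub_lt {ν m : ℕ →₀ ℕ} (hm : m ≤ ν) (h0 : m ≠ 0) :
    (ν - m).degree < ν.degree := by
  have h := congrArg Finsupp.degree (tsub_add_cancel_of_le hm)
  rw [map_add] at h
  have : m.degree ≠ 0 := by rwa [Ne, Finsupp.degree_eq_zero_iff]
  omega

theorem sum_Iic_eq_zero_add {E : Type*} [AddCommGroup E] (ν : ℕ →₀ ℕ) (F : (ℕ →₀ ℕ) → E) :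
    ∑ m ∈ Finset.Iic ν, F m = F 0 + ∑ m ∈ (Finset.Iic ν).filter (fun m => m ≠ 0), F m := by
  classical
  rw [← Finset.add_sum_erase _ _ (Finset.mem_Iic.2 (bot_le : (0 : ℕ →₀ ℕ) ≤ ν)), Finset.filter_ne']
  rfl

/-! ### Points of the parameter set -/

theorem eventually_update_mem_paramBox {y : ℕ → ℝ} (hy : y ∈ paramBox) (j : ℕ) :
    ∀ᶠ t in 𝓝 (y j), Function.update y j t ∈ paramBox := by
  filter_upwards [isOpen_Ioo.mem_nhds (hy j)] with t ht i
  by_cases hi : i = j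
  · subst hi; simpa using ht
  · simpa [hi] using hy i

theorem update_mem_paramBox {y : ℕ → ℝ} (hy : y ∈ paramBox) {j : ℕ} {t : ℝ}
    (ht : t ∈ Ioo (-(1 / 2) : ℝ) (1 / 2)) : Function.update y j t ∈ paramBox := by
  intro i
  by_cases hi : i = j
  · subst hi; simpa using ht
  · simpa [hi] using hy i

/-! ### Derivatives of the solution of a parametric operator equation -/

section Recursion

variable {K : Type*} [NormedAddCommGroup K] [NormedSpace ℝ K]

/-- The solution `w` of the recursion `w 0 = u`,
`w ν = - R (∑ 0 ≠ m ≤ ν, choose ν m • A m (w (ν - m)))`. -/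
def leibnizSolution (A : (ℕ →₀ ℕ) → K →L[ℝ] K) (R : K →L[ℝ] K) (u : K) (ν : ℕ →₀ ℕ) : K :=
  open Classical in
  if ν = 0 then u else
    -- The attached membership proofs give `m ≤ ν` and `m ≠ 0`, so that the degree of `ν - m` drops
    -- and the recursion is well founded.
    -R (∑ m ∈ ((Finset.Iic ν).filter (fun m => m ≠ 0)).attach,
      (multiChoose ν m.1 : ℝ) • A m.1 (leibnizSolution A R u (ν - m.1)))
termination_by ν.degree
decreasing_by
  have h := Finset.mem_filter.1 m.2
  exact degree_tsub_lt (Finset.mem_Iic.1 h.1) h.2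

theorem leibnizSolution_zero (A : (ℕ →₀ ℕ) → K →L[ℝ] K) (R : K →L[ℝ] K) (u : K) :
    leibnizSolution A R u 0 = u := by
  rw [leibnizSolution, if_pos rfl]

theorem leibnizSolution_of_ne (A : (ℕ →₀ ℕ) → K →L[ℝ] K) (R : K →L[ℝ] K) (u : K)
    {ν : ℕ →₀ ℕ} (hν : ν ≠ 0) :
    leibnizSolution A R u ν = -R (∑ m ∈ (Finset.Iic ν).filter (fun m => m ≠ 0),
      (multiChoose ν m : ℝ) • A m (leibnizSolution A R u (ν - m))) := by
  classical
  rw [leibnizSolution, if_neg hν]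
  congr 2
  rw [← Finset.sum_attach ((Finset.Iic ν).filter (fun m => m ≠ 0))]

theorem sum_leibnizSolution {A : (ℕ →₀ ℕ) → K →L[ℝ] K} {R : K →L[ℝ] K} (u : K)
    (hR : ∀ x, A 0 (R x) = x) {ν : ℕ →₀ ℕ} (hν : ν ≠ 0) :
    ∑ m ∈ Finset.Iic ν, (multiChoose ν m : ℝ) • A m (leibnizSolution A R u (ν - m)) = 0 := by
  rw [sum_Iic_eq_zero_add, multiChoose_zero_right, Nat.cast_one, one_smul, tsub_zero,
    leibnizSolution_of_ne A R u hν, map_neg, hR, neg_add_cancel]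

variable [CompleteSpace K]

/-- The functions `leibnizSolution` of a smooth family of operators and of the solution `u` of
`A 0 u = f` are successive partial derivatives of `u`. -/
theorem hasDerivAt_leibnizSolution {A : (ℕ →₀ ℕ) → (ℕ → ℝ) → K →L[ℝ] K}
    {R : (ℕ → ℝ) → K →L[ℝ] K} {u : (ℕ → ℝ) → K} {f : K}
    (hA : ∀ ν j, ∀ y ∈ paramBox, HasDerivAt (fun t => A ν (Function.update y j t))
      (A (ν + Finsupp.single j 1) y) (y j))
    (hAR : ∀ y ∈ paramBox, A 0 y * R y = 1) (hRA : ∀ y ∈ paramBox, R y * A 0 y = 1)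
    (hu : ∀ y ∈ paramBox, A 0 y (u y) = f) (ν : ℕ →₀ ℕ) (j : ℕ) {y : ℕ → ℝ}
    (hy : y ∈ paramBox) :
    HasDerivAt (fun t => leibnizSolution (A · (Function.update y j t))
        (R (Function.update y j t)) (u (Function.update y j t)) ν)
      (leibnizSolution (A · y) (R y) (u y) (ν + Finsupp.single j 1)) (y j) := by
  classical
  set e : ℕ →₀ ℕ := Finsupp.single j 1 with he
  set w : (ℕ →₀ ℕ) → (ℕ → ℝ) → K := fun ν y => leibnizSolution (A · y) (R y) (u y) ν with hw
  have hARx : ∀ y ∈ paramBox, ∀ x, A 0 y (R y x) = x := fun y hy x =>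
    DFunLike.congr_fun (hAR y hy) x
  have hRAx : ∀ y ∈ paramBox, ∀ x, R y (A 0 y x) = x := fun y hy x =>
    DFunLike.congr_fun (hRA y hy) x
  -- the inverse operators are differentiable
  obtain ⟨R', hR'⟩ : ∃ R', HasDerivAt (fun t => R (Function.update y j t)) R' (y j) := by
    let U : ∀ z ∈ paramBox, (K →L[ℝ] K)ˣ := fun z hz => ⟨A 0 z, R z, hAR z hz, hRA z hz⟩
    have hRinv : ∀ z ∈ paramBox, R z = Ring.inverse (A 0 z) := fun z hz =>
      (Ring.inverse_unit (U z hz)).symm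
    have h1 := hA 0 j y hy
    have h2 := hasFDerivAt_ringInverse (𝕜 := ℝ) (U y hy)
    have h3 : Function.update y j (y j) = y := Function.update_eq_self j y
    have h4 := HasFDerivAt.comp_hasDerivAt (y j) (by rw [h3]; exact h2) h1
    refine ⟨_, h4.congr_of_eventuallyEq ?_⟩
    filter_upwards [eventually_update_mem_paramBox hy j] with t ht
    exact hRinv _ ht
  -- differentiability of `w ν` and of all the earlier functions determines the derivative
  have hdiff : ∀ n : ℕ, ∀ ν : ℕ →₀ ℕ, ν.degree = n →
      HasDerivAt (fun t => w ν (Function.update y j t)) (w (ν + e) y) (y j) := by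
    intro n
    induction n using Nat.strong_induction_on with
    | _ n ih =>
    intro ν hν
    have hsum0 : ∀ z ∈ paramBox, ∑ m ∈ Finset.Iic ν, (multiChoose ν m : ℝ) •
        A m z (w (ν - m) z) = if ν = 0 then f else 0 := by
      intro z hz
      split_ifs with h0
      · subst h0
        have : Finset.Iic (0 : ℕ →₀ ℕ) = {0} := by ext m; simp
        rw [this, Finset.sum_singleton, multiChoose_zero_right, Nat.cast_one, one_smul,
          tsub_zero, hw]
        simp only [leibnizSolution_zero]
        exact hu z hz
      · exact sum_leibnizSolution (u z) (hARx z hz) h0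
    -- The right-hand side of the Leibniz identity: the data for `ν = 0`, and zero for every
    -- derivative of the equation. It is constant in the parameter in both cases.
    set g : K := if ν = 0 then f else 0
    -- Solving the identity for its term `m = 0` expresses `w ν` by `R` and by functions of lower
    -- degree, which are differentiable by induction. This gives differentiability only; the value
    -- of the derivative is found below without computing `R'`.
    have hsol : ∀ z ∈ paramBox, w ν z = R z (g - ∑ m ∈ (Finset.Iic ν).filter (fun m => m ≠ 0),
        (multiChoose ν m : ℝ) • A m z (w (ν - m) z)) := by
      intro z hz
      rw [← hsum0 z hz, sum_Iic_eq_zero_add, multiChoose_zero_right, Nat.cast_one, one_smul,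
        tsub_zero, add_sub_cancel_right, hRAx z hz]
    have hterm : ∀ m ∈ (Finset.Iic ν).filter (fun m => m ≠ 0),
        HasDerivAt (fun t => (multiChoose ν m : ℝ) •
          A m (Function.update y j t) (w (ν - m) (Function.update y j t)))
          ((multiChoose ν m : ℝ) • (A (m + e) y (w (ν - m) y) + A m y (w (ν - m + e) y)))
          (y j) := by
      intro m hm
      rw [Finset.mem_filter, Finset.mem_Iic] at hm
      have h1 := ih _ (hν ▸ degree_tsub_lt hm.1 hm.2) (ν - m) rfl
      have h2 := ((hA m j y hy).clm_apply h1).const_smul (multiChoose ν m : ℝ)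
      rw [Function.update_eq_self] at h2
      exact h2
    have hsumd := HasDerivAt.fun_sum hterm
    have hw0 : ∃ w', HasDerivAt (fun t => w ν (Function.update y j t)) w' (y j) := by
      refine ⟨_, (hR'.clm_apply (hsumd.const_sub g)).congr_of_eventuallyEq ?_⟩
      filter_upwards [eventually_update_mem_paramBox hy j] with t ht
      exact hsol _ ht
    obtain ⟨w', hw'⟩ := hw0
    have hzero := ((hA 0 j y hy).clm_apply hw').add hsumd
    have hconst : HasDerivAt (fun t => (A 0 (Function.update y j t)
        (w ν (Function.update y j t))) + ∑ m ∈ (Finset.Iic ν).filter (fun m => m ≠ 0),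
        (multiChoose ν m : ℝ) • A m (Function.update y j t)
          (w (ν - m) (Function.update y j t))) 0 (y j) := by
      refine (hasDerivAt_const (y j) g).congr_of_eventuallyEq ?_
      filter_upwards [eventually_update_mem_paramBox hy j] with t ht
      rw [← hsum0 _ ht, sum_Iic_eq_zero_add, multiChoose_zero_right, Nat.cast_one, one_smul,
        tsub_zero]
    -- The differentiated identity of order `ν` and, by Pascal's rule, the identity of order `ν + e`
    -- have the same terms except that `A 0 y` acts on `w'` in one and on `w (ν + e) y` in the
    -- other. Injectivity of `A 0 y` finishes.
    have heq := hzero.unique hconst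
    rw [Function.update_eq_self, zero_add] at heq
    have hνe : ν + e ≠ 0 := by
      intro h
      have := DFunLike.congr_fun h j
      simp [he] at this
    have hnext := sum_leibnizSolution (A := (A · y)) (R := R y) (u y) (hARx y hy) hνe
    rw [sum_multiChoose_add_single (fun m k => A m y (leibnizSolution (A · y) (R y) (u y) k)),
      sum_Iic_eq_zero_add, multiChoose_zero_right, Nat.cast_one, one_smul, tsub_zero,
      zero_add] at hnext
    have hA0 : A 0 y w' = A 0 y (w (ν + e) y) :=
      add_left_cancel (add_right_cancel (heq.trans hnext.symm))
    have : w' = w (ν + e) y := by rw [← hRAx y hy w', hA0, hRAx y hy]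
    exact this ▸ hw'
  exact hdiff _ ν rfl

end Recursion

/-! ### Induction on multi-indices, partial derivatives along coordinate lines, and Taylor's
estimate -/

theorem multiIndex_induction {p : (ℕ →₀ ℕ) → Prop} (zero : p 0)
    (add_single : ∀ ν j, p ν → p (ν + Finsupp.single j 1)) (ν : ℕ →₀ ℕ) : p ν := by
  rw [← Finsupp.toMultiset_toFinsupp ν]
  induction Finsupp.toMultiset ν using Multiset.induction_on with
  | empty => simpa using zero
  | cons j s ih =>
    rw [← Multiset.singleton_add, map_add, Multiset.toFinsupp_singleton, add_comm]
    exact add_single _ _ ih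

theorem mixedPartial_zero {F : Type*} [AddCommGroup F] [Module ℝ F] [TopologicalSpace F]
    (f : (ℕ → ℝ) → F) : mixedPartial 0 f = f := by
  simp [mixedPartial]

theorem multiPow_nonneg {x : ℕ → ℝ} (hx : ∀ j, 0 ≤ x j) (ν : ℕ →₀ ℕ) : 0 ≤ multiPow x ν :=
  Finset.prod_nonneg fun j _ => pow_nonneg (hx j) _

theorem HasAllPartials.hasDerivAt_update {F : Type*} [AddCommGroup F] [Module ℝ F]
    [TopologicalSpace F] [ContinuousSMul ℝ F] {f : (ℕ → ℝ) → F} (hf : HasAllPartials f)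
    (ν : ℕ →₀ ℕ) (j : ℕ) {y : ℕ → ℝ} (hy : y ∈ paramBox) {t : ℝ}
    (ht : t ∈ Ioo (-(1 / 2) : ℝ) (1 / 2)) :
    HasDerivAt (fun s : ℝ => mixedPartial ν f (Function.update y j s))
      (mixedPartial (ν + Finsupp.single j 1) f (Function.update y j t)) t := by
  have h := hf ν j _ (update_mem_paramBox hy (j := j) ht)
  simpa using h

/-- Taylor's estimate of second order. -/
theorem abs_sub_sub_le_of_second_deriv_le {f f' f'' : ℝ → ℝ} {s : Set ℝ} (hs : Convex ℝ s)
    (hf : ∀ t ∈ s, HasDerivAt f (f' t) t) (hf' : ∀ t ∈ s, HasDerivAt f' (f'' t) t) {B : ℝ}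
    (hB : ∀ t ∈ s, |f'' t| ≤ B) {t₀ t : ℝ} (ht₀ : t₀ ∈ s) (ht : t ∈ s) :
    |f t - f t₀ - (t - t₀) * f' t₀| ≤ B * (t - t₀) ^ 2 := by
  have hB0 : 0 ≤ B := (abs_nonneg _).trans (hB t ht)
  have hsub : uIcc t₀ t ⊆ s := by
    rw [← segment_eq_uIcc]
    exact hs.segment_subset ht₀ ht
  have h1 : ∀ r ∈ uIcc t₀ t, ‖f' r - f' t₀‖ ≤ B * |t - t₀| := by
    intro r hr
    have h := hs.norm_image_sub_le_of_norm_hasDerivWithin_le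
      (fun x hx => (hf' x hx).hasDerivWithinAt) (fun x hx => hB x hx) ht₀ (hsub hr)
    refine h.trans (mul_le_mul_of_nonneg_left ?_ hB0)
    exact abs_sub_left_of_mem_uIcc hr
  -- The mean value inequality for `f r - r * f' t₀`, whose derivative is bounded on the segment by
  -- `h1`. The factor 1/2 of Taylor's formula is given away.
  have h2 := (convex_uIcc t₀ t).norm_image_sub_le_of_norm_hasDerivWithin_le
    (f := fun r => f r - r * f' t₀) (f' := fun r => f' r - 1 * f' t₀) (C := B * |t - t₀|)
    (fun x hx => ((hf x (hsub hx)).sub ((hasDerivAt_id x).mul_const (f' t₀))).hasDerivWithinAt)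
    (fun x hx => by simpa using h1 x hx) left_mem_uIcc right_mem_uIcc
  rw [Real.norm_eq_abs, Real.norm_eq_abs, mul_assoc, ← sq, sq_abs] at h2
  convert h2 using 2
  ring

/-! ### The conductivity as a smooth map into `L^∞(D)` -/

namespace Geometry

variable {d M : ℕ} {G : Geometry d M} {a : EuclideanSpace ℝ (Fin d) → (ℕ → ℝ) → ℝ} {C σ : ℝ}
  {ρ : ℕ → ℝ} {amin amax : ℝ}

theorem ae_mem_D (G : Geometry d M) : ∀ᵐ x ∂G.vol, x ∈ G.D :=
  ae_restrict_mem G.isOpen_D.measurableSet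

namespace Conductivity

/-- A bound on `eLpNorm` says nothing about measurability. It is inherited from `a(·, y)` by
induction, each derivative being the almost everywhere limit of a sequence of difference quotients.
-/
theorem aestronglyMeasurable_mixedPartial (ha : G.Conductivity a C σ ρ amin amax) (ν : ℕ →₀ ℕ) :
    ∀ y ∈ paramBox, AEStronglyMeasurable (fun x => mixedPartial ν (a x) y) G.vol := by
  induction ν using multiIndex_induction with
  | zero =>
    intro y hy
    simpa [mixedPartial_zero] using (ha.memLp y hy).1
  | add_single ν j ih =>
    intro y hy
    -- A sequence decreasing to `y j`; as `n + 2 > 1`, it stays below `1 / 2`.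
    set t : ℕ → ℝ := fun n => y j + (1 / 2 - y j) / ((n : ℝ) + 2) with ht
    have hpos : 0 < 1 / 2 - y j := sub_pos.2 (hy j).2
    have hlim : Tendsto t atTop (𝓝 (y j)) := by
      have h1 : Tendsto (fun n : ℕ => (n : ℝ) + 2) atTop atTop :=
        tendsto_atTop_add_const_right _ _ tendsto_natCast_atTop_atTop
      simpa [ht] using (tendsto_const_nhds (x := y j)).add (h1.const_div_atTop (1 / 2 - y j))
    have hgt : ∀ n, y j < t n := fun n => lt_add_of_pos_right _ (by positivity)
    have hmem : ∀ n, t n ∈ Ioo (-(1 / 2) : ℝ) (1 / 2) := by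
      intro n
      refine ⟨(hy j).1.trans (hgt n), ?_⟩
      have : (1 / 2 - y j) / ((n : ℝ) + 2) < 1 / 2 - y j :=
        div_lt_self hpos (by have := n.cast_nonneg (α := ℝ); linarith)
      simp only [ht]
      linarith
    have hlim' : Tendsto t atTop (𝓝[≠] (y j)) :=
      tendsto_nhdsWithin_iff.2 ⟨hlim, .of_forall fun n => (hgt n).ne'⟩
    refine aestronglyMeasurable_of_tendsto_ae atTop (f := fun n x => (t n - y j)⁻¹ *
      (mixedPartial ν (a x) (Function.update y j (t n)) - mixedPartial ν (a x) y)) ?_ ?_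
    · exact fun n => ((ih _ (update_mem_paramBox hy (hmem n))).sub (ih y hy)).const_mul _
    · filter_upwards [G.ae_mem_D] with x hx
      have h := (ha.partials x hx ν j y hy).tendsto_slope.comp hlim'
      refine h.congr fun n => ?_
      simp [slope_def_module]

/-- The Gevrey bound of the derivative of order `ν`. -/
theorem gevrey_bound_nonneg (ha : G.Conductivity a C σ ρ amin amax) (ν : ℕ →₀ ℕ) :
    0 ≤ C * (Nat.factorial ν.degree : ℝ) ^ σ * multiPow ρ ν := by
  have := ha.one_le_C
  have := multiPow_nonneg ha.ρ_nonneg ν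
  positivity

theorem ae_abs_mixedPartial_le (ha : G.Conductivity a C σ ρ amin amax) (ν : ℕ →₀ ℕ) {y : ℕ → ℝ}
    (hy : y ∈ paramBox) :
    ∀ᵐ x ∂G.vol, |mixedPartial ν (a x) y| ≤
      C * (Nat.factorial ν.degree : ℝ) ^ σ * multiPow ρ ν := by
  have h := ha.gevrey ν y hy
  rw [eLpNorm_exponent_top] at h
  filter_upwards [ae_le_eLpNormEssSup (f := fun x => mixedPartial ν (a x) y) (μ := G.vol)]
    with x hx
  have h1 := hx.trans h
  rw [← ofReal_norm] at h1
  exact (ENNReal.ofReal_le_ofReal_iff (ha.gevrey_bound_nonneg ν)).1 h1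

theorem memLp_mixedPartial (ha : G.Conductivity a C σ ρ amin amax) (ν : ℕ →₀ ℕ) {y : ℕ → ℝ}
    (hy : y ∈ paramBox) : MemLp (fun x => mixedPartial ν (a x) y) ⊤ G.vol :=
  ⟨ha.aestronglyMeasurable_mixedPartial ν y hy, (ha.gevrey ν y hy).trans_lt ENNReal.ofReal_lt_top⟩

/-- Along a coordinate line, the exceptional null sets of the Gevrey bounds can be chosen
independently of the parameter. -/
theorem ae_forall_abs_mixedPartial_le (ha : G.Conductivity a C σ ρ amin amax) (ν : ℕ →₀ ℕ)
    (j : ℕ) {y : ℕ → ℝ} (hy : y ∈ paramBox) :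
    ∀ᵐ x ∂G.vol, ∀ t ∈ Ioo (-(1 / 2) : ℝ) (1 / 2),
      |mixedPartial ν (a x) (Function.update y j t)| ≤
        C * (Nat.factorial ν.degree : ℝ) ^ σ * multiPow ρ ν := by
  have h1 : ∀ᵐ x ∂G.vol, ∀ q : ℚ, (q : ℝ) ∈ Ioo (-(1 / 2) : ℝ) (1 / 2) →
      |mixedPartial ν (a x) (Function.update y j q)| ≤
        C * (Nat.factorial ν.degree : ℝ) ^ σ * multiPow ρ ν := by
    refine ae_all_iff.2 fun q => ?_
    by_cases hq : (q : ℝ) ∈ Ioo (-(1 / 2) : ℝ) (1 / 2)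
    · filter_upwards [ha.ae_abs_mixedPartial_le ν (update_mem_paramBox hy (j := j) hq)]
        with x hx _ using hx
    · exact .of_forall fun x h => absurd h hq
  filter_upwards [h1, G.ae_mem_D] with x hx hxD t ht
  by_contra! hlt
  -- For fixed `x` the parameters violating the bound form an open set, so that a violation would
  -- also occur at a rational parameter; the rational ones need only countably many null sets.
  have hcont : ContinuousOn (fun s : ℝ => |mixedPartial ν (a x) (Function.update y j s)|)
      (Ioo (-(1 / 2) : ℝ) (1 / 2)) := fun s hs =>
    ((ha.partials x hxD).hasDerivAt_update ν j hy hs).continuousAt.abs.continuousWithinAt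
  have hopen := hcont.isOpen_inter_preimage isOpen_Ioo (isOpen_Ioi
    (a := C * (Nat.factorial ν.degree : ℝ) ^ σ * multiPow ρ ν))
  obtain ⟨q, hq⟩ := Rat.denseRange_cast.exists_mem_open hopen ⟨t, ht, hlt⟩
  exact absurd (hx q hq.1) (not_le.2 hq.2)

open Classical in
/-- The derivative of order `ν` of the conductivity, as an element of `L^∞(D)`. -/
def _root_.CEM.Geometry.coeff (G : Geometry d M)
    (a : EuclideanSpace ℝ (Fin d) → (ℕ → ℝ) → ℝ) (ν : ℕ →₀ ℕ) (y : ℕ → ℝ) : Lp ℝ ⊤ G.vol :=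
  if h : MemLp (fun x => mixedPartial ν (a x) y) ⊤ G.vol then h.toLp _ else 0

theorem coeff_coeFn (ha : G.Conductivity a C σ ρ amin amax) (ν : ℕ →₀ ℕ) {y : ℕ → ℝ}
    (hy : y ∈ paramBox) : G.coeff a ν y =ᵐ[G.vol] fun x => mixedPartial ν (a x) y := by
  rw [coeff, dif_pos (ha.memLp_mixedPartial ν hy)]
  exact MemLp.coeFn_toLp _

theorem _root_.CEM.Geometry.norm_Lp_top_le {f : Lp ℝ ⊤ G.vol} {B : ℝ} (hB : 0 ≤ B)
    (h : ∀ᵐ x ∂G.vol, |f x| ≤ B) : ‖f‖ ≤ B := by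
  have h' : ∀ᵐ x ∂G.vol, ‖f x‖ ≤ B := h
  simpa using Lp.norm_le_of_ae_bound hB h'

theorem norm_coeff_le (ha : G.Conductivity a C σ ρ amin amax) (ν : ℕ →₀ ℕ) {y : ℕ → ℝ}
    (hy : y ∈ paramBox) :
    ‖G.coeff a ν y‖ ≤ C * (Nat.factorial ν.degree : ℝ) ^ σ * multiPow ρ ν := by
  refine norm_Lp_top_le (ha.gevrey_bound_nonneg ν) ?_
  filter_upwards [ha.coeff_coeFn ν hy, ha.ae_abs_mixedPartial_le ν hy] with x h1 h2
  rwa [h1]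

/-- Outside one null set, Taylor's estimate holds for all `t` with a remainder constant `B`
independent of `x`, so the remainder is quadratic in the norm of `L^∞(D)`. -/
theorem hasDerivAt_coeff (ha : G.Conductivity a C σ ρ amin amax) (ν : ℕ →₀ ℕ) (j : ℕ)
    {y : ℕ → ℝ} (hy : y ∈ paramBox) :
    HasDerivAt (fun t => G.coeff a ν (Function.update y j t))
      (G.coeff a (ν + Finsupp.single j 1) y) (y j) := by
  set e : ℕ →₀ ℕ := Finsupp.single j 1
  set B : ℝ := C * (Nat.factorial (ν + e + e).degree : ℝ) ^ σ * multiPow ρ (ν + e + e)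
  have hbound : ∀ t ∈ Ioo (-(1 / 2) : ℝ) (1 / 2), ‖G.coeff a ν (Function.update y j t) -
      G.coeff a ν (Function.update y j (y j)) - (t - y j) • G.coeff a (ν + e) y‖ ≤
        B * ‖‖t - y j‖ ^ 2‖ := by
    intro t ht
    rw [Function.update_eq_self, Real.norm_eq_abs, abs_of_nonneg (sq_nonneg _), Real.norm_eq_abs,
      sq_abs]
    refine norm_Lp_top_le (mul_nonneg (ha.gevrey_bound_nonneg _) (sq_nonneg _)) ?_
    filter_upwards [ha.coeff_coeFn ν (update_mem_paramBox hy (j := j) ht), ha.coeff_coeFn ν hy,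
      ha.coeff_coeFn (ν + e) hy, Lp.coeFn_sub (G.coeff a ν (Function.update y j t) -
        G.coeff a ν y) ((t - y j) • G.coeff a (ν + e) y),
      Lp.coeFn_sub (G.coeff a ν (Function.update y j t)) (G.coeff a ν y),
      Lp.coeFn_smul (t - y j) (G.coeff a (ν + e) y), G.ae_mem_D,
      ha.ae_forall_abs_mixedPartial_le (ν + e + e) j hy] with x h1 h2 h3 h4 h5 h6 hxD h7
    rw [h4, Pi.sub_apply, h5, Pi.sub_apply, h6, Pi.smul_apply, h1, h2, h3, smul_eq_mul]
    have h := abs_sub_sub_le_of_second_deriv_le (convex_Ioo (-(1 / 2) : ℝ) (1 / 2))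
      (fun s hs => (ha.partials x hxD).hasDerivAt_update ν j hy hs)
      (fun s hs => (ha.partials x hxD).hasDerivAt_update (ν + e) j hy hs) h7 (hy j) ht
    rwa [Function.update_eq_self] at h
  rw [hasDerivAt_iff_isLittleO]
  refine Asymptotics.IsBigO.trans_isLittleO (g := fun t => ‖t - y j‖ ^ 2) ?_
    (Asymptotics.isLittleO_pow_sub_sub (y j) one_lt_two)
  refine Asymptotics.IsBigO.of_bound B ?_
  filter_upwards [isOpen_Ioo.mem_nhds (hy j)] with t ht using hbound t ht

end Conductivity

end Geometry

/-! ### The Poincaré inequality -/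

section Poincare

open scoped ENNReal

variable {E : Type*} [NormedAddCommGroup E] [NormedSpace ℝ E]

theorem setLIntegral_translate_le {F : Type*} [AddGroup F] [MeasurableSpace F] [MeasurableAdd F]
    (μ : Measure F) [μ.IsAddRightInvariant] {f : F → ℝ≥0∞} (hf : Measurable f)
    {S D : Set F} (hD : MeasurableSet D) {v : F} (h : ∀ x ∈ S, x + v ∈ D) :
    ∫⁻ x in S, f (x + v) ∂μ ≤ ∫⁻ x in D, f x ∂μ := by
  have hg : Measurable (D.indicator f) := hf.indicator hD
  calc ∫⁻ x in S, f (x + v) ∂μ ≤ ∫⁻ x in S, D.indicator f (x + v) ∂μ := by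
        refine setLIntegral_mono (hg.comp (measurable_add_const v)) fun x hx => ?_
        rw [indicator_of_mem (h x hx)]
    _ ≤ ∫⁻ x, D.indicator f (x + v) ∂μ := setLIntegral_le_lintegral _ _
    _ = ∫⁻ x, D.indicator f x ∂μ := lintegral_add_right_eq_self _ v
    _ = _ := lintegral_indicator hD f

theorem enorm_sub_sq_le (a b c : ℝ) : ‖a - c‖ₑ ^ 2 ≤ 2 * (‖a - b‖ₑ ^ 2 + ‖b - c‖ₑ ^ 2) := by
  have h : (‖a - b‖₊ + ‖b - c‖₊) ^ 2 ≤ 2 * (‖a - b‖₊ ^ 2 + ‖b - c‖₊ ^ 2) := add_sq_le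
  have h' : ‖a - c‖₊ ≤ ‖a - b‖₊ + ‖b - c‖₊ := by
    rw [← sub_add_sub_cancel a b c]
    exact nnnorm_add_le _ _
  simp only [enorm_eq_nnnorm]
  exact_mod_cast (pow_le_pow_left' h' 2).trans h

/-- Cauchy–Schwarz against the constant `1`, on an interval of length one. -/
theorem sq_setLIntegral_Ioc_le {f : ℝ → ℝ≥0∞} (hf : Measurable f) :
    (∫⁻ s in Ioc (0 : ℝ) 1, f s) ^ 2 ≤ ∫⁻ s in Ioc (0 : ℝ) 1, f s ^ 2 := by
  have h := ENNReal.lintegral_mul_le_Lp_mul_Lq (volume.restrict (Ioc (0 : ℝ) 1))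
    Real.HolderConjugate.two_two hf.aemeasurable (aemeasurable_const (b := (1 : ℝ≥0∞)))
  simp only [Pi.mul_apply, lintegral_const, Measure.restrict_apply_univ, Real.volume_Ioc,
    sub_zero, ENNReal.ofReal_one, mul_one, ENNReal.rpow_two, one_pow,
    ENNReal.one_rpow] at h
  calc (∫⁻ s in Ioc (0 : ℝ) 1, f s) ^ 2
      ≤ ((∫⁻ s in Ioc (0 : ℝ) 1, f s ^ 2) ^ (1 / 2 : ℝ)) ^ 2 := by gcongr
    _ = _ := by
      rw [← ENNReal.rpow_two, ← ENNReal.rpow_mul]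
      norm_num

/-- Two values of a differentiable function, compared by the integral of its derivative over
the segment. -/
theorem enorm_sub_sq_le_lintegral_fderiv {φ : E → ℝ} (hφ : ContDiff ℝ 1 φ) (x v : E) {s : ℝ}
    (hs : s ∈ Ioc (0 : ℝ) 1) :
    ‖φ (x + s • v) - φ x‖ₑ ^ 2 ≤
      ‖v‖ₑ ^ 2 * ∫⁻ t in Ioc (0 : ℝ) 1, ‖fderiv ℝ φ (x + t • v)‖ₑ ^ 2 := by
  have hline : Continuous fun t : ℝ => x + t • v := by fun_prop
  have hcont : Continuous fun t : ℝ => fderiv ℝ φ (x + t • v) :=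
    (hφ.continuous_fderiv one_ne_zero).comp hline
  have hderiv : ∀ t : ℝ, HasDerivAt (fun t : ℝ => φ (x + t • v)) (fderiv ℝ φ (x + t • v) v) t := by
    intro t
    have h1 : HasDerivAt (fun t : ℝ => x + t • v) v t := by
      simpa using ((hasDerivAt_id t).smul_const v).const_add x
    exact (hφ.differentiable one_ne_zero _).hasFDerivAt.comp_hasDerivAt t h1
  have hint := intervalIntegral.integral_eq_sub_of_hasDerivAt (a := 0) (b := s)
    (fun t _ => hderiv t) ((hcont.clm_apply continuous_const).intervalIntegrable _ _)
  rw [zero_smul, add_zero, intervalIntegral.integral_of_le hs.1.le] at hint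
  rw [← hint]
  have h1 : ‖∫ t in Ioc 0 s, fderiv ℝ φ (x + t • v) v‖ₑ ≤
      ‖v‖ₑ * ∫⁻ t in Ioc (0 : ℝ) 1, ‖fderiv ℝ φ (x + t • v)‖ₑ := by
    refine (enorm_integral_le_lintegral_enorm _).trans ?_
    rw [← lintegral_const_mul _ hcont.enorm.measurable]
    refine (lintegral_mono_set (Ioc_subset_Ioc_right hs.2)).trans (lintegral_mono fun t => ?_)
    rw [mul_comm]
    exact ContinuousLinearMap.le_opENorm _ _
  calc _ ≤ (‖v‖ₑ * ∫⁻ t in Ioc (0 : ℝ) 1, ‖fderiv ℝ φ (x + t • v)‖ₑ) ^ 2 := by gcongr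
    _ ≤ _ := by
      rw [mul_pow]
      gcongr
      exact sq_setLIntegral_Ioc_le hcont.enorm.measurable

variable [MeasurableSpace E] (μ : Measure E)

/-- The functions that are smooth on the whole space satisfy a Poincaré inequality on `S`, with
the gradient on the possibly larger set `D`. -/
def PoincareOn (D S : Set E) : Prop :=
  ∃ C : ℝ≥0∞, C ≠ ⊤ ∧ ∀ φ : E → ℝ, ContDiff ℝ 1 φ → ∃ c : ℝ,
    ∫⁻ x in S, ‖φ x - c‖ₑ ^ 2 ∂μ ≤ C * ∫⁻ x in D, ‖fderiv ℝ φ x‖ₑ ^ 2 ∂μ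

theorem PoincareOn.mono {μ : Measure E} {D S T : Set E} (h : PoincareOn μ D T) (hST : S ⊆ T) :
    PoincareOn μ D S := by
  obtain ⟨C, hC, h⟩ := h
  refine ⟨C, hC, fun φ hφ => ?_⟩
  obtain ⟨c, hc⟩ := h φ hφ
  exact ⟨c, (lintegral_mono_set hST).trans hc⟩

variable [BorelSpace E]

/-- On the overlap both constants `a` and `b` approximate `φ`; as the overlap has positive measure,
`|b - a|²` is controlled by the gradient integral. Hence `a` also serves on `B`. -/
theorem PoincareOn.union {μ : Measure E} {D A B : Set E} (hA : PoincareOn μ D A) (hB : PoincareOn μ D B)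
    (hpos : μ (A ∩ B) ≠ 0) (hBfin : μ B ≠ ⊤) : PoincareOn μ D (A ∪ B) := by
  obtain ⟨CA, hCA, hA⟩ := hA
  obtain ⟨CB, hCB, hB⟩ := hB
  have hfin : μ (A ∩ B) ≠ ⊤ := measure_ne_top_of_subset inter_subset_right hBfin
  refine ⟨CA + 2 * (CB + (2 * (CA + CB) / μ (A ∩ B)) * μ B), ?_, fun φ hφ => ?_⟩
  · have := ENNReal.div_ne_top (x := 2 * (CA + CB)) (by finiteness) hpos
    finiteness
  obtain ⟨a, ha⟩ := hA φ hφ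
  obtain ⟨b, hb⟩ := hB φ hφ
  set J := ∫⁻ x in D, ‖fderiv ℝ φ x‖ₑ ^ 2 ∂μ
  have hm : ∀ c : ℝ, Measurable fun x => ‖φ x - c‖ₑ ^ 2 := by
    have := hφ.continuous
    exact fun c => (Continuous.measurable (by fun_prop)).pow_const 2
  have hab : ‖b - a‖ₑ ^ 2 * μ (A ∩ B) ≤ 2 * (CA + CB) * J := by
    calc ‖b - a‖ₑ ^ 2 * μ (A ∩ B) = ∫⁻ x in A ∩ B, ‖b - a‖ₑ ^ 2 ∂μ := by simp
      _ ≤ ∫⁻ x in A ∩ B, 2 * (‖φ x - a‖ₑ ^ 2 + ‖φ x - b‖ₑ ^ 2) ∂μ := by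
        refine lintegral_mono fun x => ?_
        have := enorm_sub_sq_le b (φ x) a
        rwa [enorm_sub_rev b (φ x), add_comm] at this
      _ = 2 * (∫⁻ x in A ∩ B, ‖φ x - a‖ₑ ^ 2 ∂μ + ∫⁻ x in A ∩ B, ‖φ x - b‖ₑ ^ 2 ∂μ) := by
        rw [lintegral_const_mul' _ _ (by finiteness), lintegral_add_left (hm a)]
      _ ≤ 2 * (CA * J + CB * J) := by
        gcongr 2 * (?_ + ?_)
        · exact (lintegral_mono_set inter_subset_left).trans ha
        · exact (lintegral_mono_set inter_subset_right).trans hb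
      _ = _ := by ring
  have hab' : ‖b - a‖ₑ ^ 2 ≤ (2 * (CA + CB) / μ (A ∩ B)) * J := by
    rw [← ENNReal.le_div_iff_mul_le (.inl hpos) (.inl hfin)] at hab
    refine hab.trans_eq ?_
    simp only [div_eq_mul_inv]
    ring
  refine ⟨a, (lintegral_union_le _ _ _).trans ?_⟩
  calc _ ≤ CA * J + 2 * (CB * J + (2 * (CA + CB) / μ (A ∩ B)) * J * μ B) := by
        refine add_le_add ha ?_
        calc ∫⁻ x in B, ‖φ x - a‖ₑ ^ 2 ∂μ
            ≤ ∫⁻ x in B, 2 * (‖φ x - b‖ₑ ^ 2 + ‖b - a‖ₑ ^ 2) ∂μ :=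
              lintegral_mono fun x => enorm_sub_sq_le _ _ _
          _ = 2 * (∫⁻ x in B, ‖φ x - b‖ₑ ^ 2 ∂μ + ‖b - a‖ₑ ^ 2 * μ B) := by
              rw [lintegral_const_mul' _ _ (by finiteness), lintegral_add_left (hm b)]
              simp
          _ ≤ _ := by gcongr
    _ = _ := by ring

/-- The Poincaré inequality on a connected open set with compact closure follows from local
Poincaré inequalities at the points of the closure. -/
theorem poincareOn_self_of_local {μ : Measure E} [μ.IsAddHaarMeasure] {D : Set E} (hDo : IsOpen D)
    (hDc : IsConnected D) (hDcpt : IsCompact (closure D))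
    (h : ∀ x ∈ closure D, ∃ η > 0, PoincareOn μ D (D ∩ Metric.ball x η)) :
    PoincareOn μ D D := by
  classical
  have hDfin : μ D ≠ ⊤ := measure_ne_top_of_subset subset_closure hDcpt.measure_ne_top
  choose! η hη hP using h
  obtain ⟨t, htD, hcover⟩ := hDcpt.elim_nhds_subcover (fun x => Metric.ball x (η x))
    (fun x hx => Metric.ball_mem_nhds x (hη x hx))
  set A : E → Set E := fun x => D ∩ Metric.ball x (η x)
  have hAo : ∀ x, IsOpen (A x) := fun x => hDo.inter Metric.isOpen_ball
  have hAne : ∀ x ∈ t, (D ∩ A x).Nonempty := by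
    intro x hx
    have := mem_closure_iff.1 (htD x hx) _ Metric.isOpen_ball
      (Metric.mem_ball_self (hη x (htD x hx)))
    obtain ⟨z, hz1, hz2⟩ := this
    exact ⟨z, hz2, hz2, hz1⟩
  obtain ⟨x₁, hx₁⟩ := hDc.nonempty
  obtain ⟨i₁, hi₁, -⟩ := mem_iUnion₂.1 (hcover (subset_closure hx₁))
  -- Among the subfamilies of the finite cover that contain `i₁` and whose union satisfies the
  -- inequality, one of maximal size is taken.
  have hFne : (t.powerset.filter fun T => i₁ ∈ T ∧ PoincareOn μ D (⋃ i ∈ T, A i)).Nonempty := by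
    refine ⟨{i₁}, ?_⟩
    simp only [Finset.mem_filter, Finset.mem_powerset, Finset.singleton_subset_iff,
      Finset.mem_singleton, iUnion_iUnion_eq_left, true_and]
    exact ⟨hi₁, hP i₁ (htD i₁ hi₁)⟩
  obtain ⟨T, hT, hmax⟩ := Finset.exists_max_image _ Finset.card hFne
  simp only [Finset.mem_filter, Finset.mem_powerset] at hT
  obtain ⟨hTt, hi₁T, hTP⟩ := hT
  by_cases hDT : D ⊆ ⋃ i ∈ T, A i
  · exact hTP.mono hDT
  exfalso
  obtain ⟨x₂, hx₂, hx₂T⟩ := not_subset.1 hDT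
  have hcov : ∀ x ∈ D, ∃ i ∈ t, x ∈ A i := by
    intro x hx
    obtain ⟨i, hi, hxi⟩ := mem_iUnion₂.1 (hcover (subset_closure hx))
    exact ⟨i, hi, hx, hxi⟩
  have hDUW : D ⊆ (⋃ i ∈ T, A i) ∪ ⋃ i ∈ t \ T, A i := by
    intro x hx
    obtain ⟨i, hi, hxi⟩ := hcov x hx
    by_cases hiT : i ∈ T
    · exact .inl (mem_iUnion₂.2 ⟨i, hiT, hxi⟩)
    · exact .inr (mem_iUnion₂.2 ⟨i, Finset.mem_sdiff.2 ⟨hi, hiT⟩, hxi⟩)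
  have hU : (D ∩ ⋃ i ∈ T, A i).Nonempty := by
    obtain ⟨z, hz⟩ := hAne i₁ hi₁
    exact ⟨z, hz.1, mem_iUnion₂.2 ⟨i₁, hi₁T, hz.2⟩⟩
  have hW : (D ∩ ⋃ i ∈ t \ T, A i).Nonempty := ⟨x₂, hx₂, (hDUW hx₂).resolve_left hx₂T⟩
  -- If the maximal union missed a point of `D`, connectedness would make it meet one of the
  -- remaining open pieces. The overlap is open and nonempty, hence of positive measure, and that
  -- piece could be added.
  obtain ⟨z, -, hzU, hzW⟩ := hDc.isPreconnected _ _ (isOpen_biUnion fun i _ => hAo i)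
    (isOpen_biUnion fun i _ => hAo i) hDUW hU hW
  obtain ⟨i, hi, hzi⟩ := mem_iUnion₂.1 hzW
  replace hi := Finset.mem_sdiff.1 (Finset.mem_coe.1 hi)
  have hpos : μ ((⋃ i ∈ T, A i) ∩ A i) ≠ 0 :=
    (((isOpen_biUnion fun i _ => hAo i).inter (hAo i)).measure_pos μ ⟨z, hzU, hzi⟩).ne'
  have hnew := hTP.union (hP i (htD i hi.1)) hpos
    (measure_ne_top_of_subset inter_subset_left hDfin)
  have := hmax (insert i T) (by
    simp only [Finset.mem_filter, Finset.mem_powerset]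
    refine ⟨Finset.insert_subset hi.1 hTt, Finset.mem_insert_of_mem hi₁T, ?_⟩
    rw [Finset.set_biUnion_insert, union_comm]
    exact hnew)
  rw [Finset.card_insert_of_notMem hi.2] at this
  omega

variable [FiniteDimensional ℝ E]

/-- The pointwise estimate along the segment from `x` to `x + v` is integrated over `S`; after
exchanging the integrals, each translate of `S` by `t • v` lies in `D`. -/
theorem lintegral_shift_sub_sq_le [μ.IsAddHaarMeasure] {φ : E → ℝ} (hφ : ContDiff ℝ 1 φ)
    {S D : Set E} (hD : MeasurableSet D) {v : E}
    (h : ∀ x ∈ S, ∀ s ∈ Ioc (0 : ℝ) 1, x + s • v ∈ D) :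
    ∫⁻ x in S, ‖φ (x + v) - φ x‖ₑ ^ 2 ∂μ ≤ ‖v‖ₑ ^ 2 * ∫⁻ x in D, ‖fderiv ℝ φ x‖ₑ ^ 2 ∂μ := by
  have hm : Measurable fun p : E × ℝ => ‖fderiv ℝ φ (p.1 + p.2 • v)‖ₑ ^ 2 := by
    have h1 : Continuous fun p : E × ℝ => fderiv ℝ φ (p.1 + p.2 • v) :=
      (hφ.continuous_fderiv one_ne_zero).comp (by fun_prop)
    exact h1.enorm.measurable.pow_const 2
  have hf : Measurable fun x => ‖fderiv ℝ φ x‖ₑ ^ 2 :=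
    (hφ.continuous_fderiv one_ne_zero).enorm.measurable.pow_const 2
  have hmeas : Measurable fun x =>
      ∫⁻ t in Ioc (0 : ℝ) 1, ‖fderiv ℝ φ (x + t • v)‖ₑ ^ 2 := hm.lintegral_prod_right
  calc ∫⁻ x in S, ‖φ (x + v) - φ x‖ₑ ^ 2 ∂μ
      ≤ ∫⁻ x in S, (‖v‖ₑ ^ 2 * ∫⁻ t in Ioc (0 : ℝ) 1, ‖fderiv ℝ φ (x + t • v)‖ₑ ^ 2) ∂μ := by
        refine lintegral_mono fun x => ?_
        simpa using enorm_sub_sq_le_lintegral_fderiv hφ x v (right_mem_Ioc.2 one_pos)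
    _ = ‖v‖ₑ ^ 2 * ∫⁻ t in Ioc (0 : ℝ) 1, ∫⁻ x in S, ‖fderiv ℝ φ (x + t • v)‖ₑ ^ 2 ∂μ := by
        rw [lintegral_const_mul _ hmeas, lintegral_lintegral_swap hm.aemeasurable]
    _ ≤ ‖v‖ₑ ^ 2 * ∫⁻ t in Ioc (0 : ℝ) 1, ∫⁻ x in D, ‖fderiv ℝ φ x‖ₑ ^ 2 ∂μ := by
        refine mul_le_mul_right ?_ _
        refine setLIntegral_mono measurable_const fun t ht => ?_
        exact setLIntegral_translate_le μ hf hD fun x hx => h x hx t ht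
    _ = _ := by simp

variable {μ}

/-- `φ x` is compared with `φ (x + v)`, where the inequality on `T` applies. This carries the
inequality from an interior ball to a piece of the domain touching the boundary. -/
theorem PoincareOn.of_shift [μ.IsAddHaarMeasure] {D S T : Set E} (hT : PoincareOn μ D T)
    (hD : MeasurableSet D) (hTm : MeasurableSet T) {v : E} (hv : ∀ x ∈ S, x + v ∈ T)
    (h : ∀ x ∈ S, ∀ s ∈ Ioc (0 : ℝ) 1, x + s • v ∈ D) : PoincareOn μ D S := by
  obtain ⟨C, hC, hT⟩ := hT
  refine ⟨2 * (‖v‖ₑ ^ 2 + C), by finiteness, fun φ hφ => ?_⟩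
  obtain ⟨c, hc⟩ := hT φ hφ
  refine ⟨c, ?_⟩
  have hm : Measurable fun x => ‖φ (x + v) - φ x‖ₑ ^ 2 := by
    have := hφ.continuous
    exact (Continuous.measurable (by fun_prop)).pow_const 2
  have hm' : Measurable fun x => ‖φ x - c‖ₑ ^ 2 := by
    have := hφ.continuous
    exact (Continuous.measurable (by fun_prop)).pow_const 2
  calc ∫⁻ x in S, ‖φ x - c‖ₑ ^ 2 ∂μ
      ≤ ∫⁻ x in S, 2 * (‖φ (x + v) - φ x‖ₑ ^ 2 + ‖φ (x + v) - c‖ₑ ^ 2) ∂μ := by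
        refine lintegral_mono fun x => ?_
        have := enorm_sub_sq_le (φ x) (φ (x + v)) c
        rwa [enorm_sub_rev (φ x) (φ (x + v))] at this
    _ = 2 * (∫⁻ x in S, ‖φ (x + v) - φ x‖ₑ ^ 2 ∂μ + ∫⁻ x in S, ‖φ (x + v) - c‖ₑ ^ 2 ∂μ) := by
        rw [lintegral_const_mul' _ _ (by finiteness), lintegral_add_left hm]
    _ ≤ 2 * (‖v‖ₑ ^ 2 * ∫⁻ x in D, ‖fderiv ℝ φ x‖ₑ ^ 2 ∂μ +
          C * ∫⁻ x in D, ‖fderiv ℝ φ x‖ₑ ^ 2 ∂μ) := by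
        gcongr 2 * (?_ + ?_)
        · exact lintegral_shift_sub_sq_le μ hφ hD h
        · exact (setLIntegral_translate_le μ hm' hTm hv).trans hc
    _ = _ := by ring

/-- The constant is a value `φ y` at a point where the mean square deviation does not exceed its
average over the ball. The resulting double integral is rewritten with `v = y - x`, `‖v‖ < 2η`, and
the segments from `x` to `x + v` stay in the ball of radius `3η`. -/
theorem poincareOn_ball [μ.IsAddHaarMeasure] {D : Set E} (hD : MeasurableSet D) {x₀ : E} {η : ℝ}
    (hη : 0 < η) (h : Metric.ball x₀ (3 * η) ⊆ D) : PoincareOn μ D (Metric.ball x₀ η) := by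
  set B := Metric.ball x₀ η
  have hB0 : μ B ≠ 0 := (Metric.measure_ball_pos μ x₀ hη).ne'
  have hBfin : μ B ≠ ⊤ := measure_ball_lt_top.ne
  set Q := Metric.ball (0 : E) (2 * η)
  have hQfin : μ Q ≠ ⊤ := measure_ball_lt_top.ne
  refine ⟨ENNReal.ofReal (2 * η) ^ 2 * μ Q / μ B, ENNReal.div_ne_top (by finiteness) hB0,
    fun φ hφ => ?_⟩
  set J := ∫⁻ x in D, ‖fderiv ℝ φ x‖ₑ ^ 2 ∂μ
  have hφc := hφ.continuous
  have hm₁ : Measurable fun p : E × E => ‖φ p.1 - φ p.2‖ₑ ^ 2 :=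
    (Continuous.measurable (by fun_prop)).pow_const 2
  have hm₂ : Measurable fun p : E × E => ‖φ (p.1 + p.2) - φ p.1‖ₑ ^ 2 :=
    (Continuous.measurable (by fun_prop)).pow_const 2
  have hmeas : Measurable fun y => ∫⁻ x in B, ‖φ x - φ y‖ₑ ^ 2 ∂μ :=
    hm₁.lintegral_prod_left'
  obtain ⟨y, -, hy⟩ := exists_le_setLAverage hB0 hBfin hmeas.aemeasurable
  refine ⟨φ y, hy.trans ?_⟩
  rw [setLAverage_eq]
  suffices hdouble : ∫⁻ y in B, ∫⁻ x in B, ‖φ x - φ y‖ₑ ^ 2 ∂μ ∂μ ≤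
      ENNReal.ofReal (2 * η) ^ 2 * μ Q * J by
    calc _ ≤ ENNReal.ofReal (2 * η) ^ 2 * μ Q * J / μ B := by gcongr
      _ = _ := by simp only [div_eq_mul_inv]; ring
  calc ∫⁻ y in B, ∫⁻ x in B, ‖φ x - φ y‖ₑ ^ 2 ∂μ ∂μ
      = ∫⁻ x in B, ∫⁻ y in B, ‖φ x - φ y‖ₑ ^ 2 ∂μ ∂μ :=
        lintegral_lintegral_swap (hm₁.comp measurable_swap).aemeasurable
    _ ≤ ∫⁻ x in B, ∫⁻ v in Q, ‖φ (x + v) - φ x‖ₑ ^ 2 ∂μ ∂μ := by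
        refine setLIntegral_mono hm₂.lintegral_prod_right' fun x hx => ?_
        have hm : Measurable fun v => ‖φ (x + v) - φ x‖ₑ ^ 2 :=
          (Continuous.measurable (by fun_prop)).pow_const 2
        have := setLIntegral_translate_le μ hm (S := B) (D := Q) Metric.isOpen_ball.measurableSet
          (v := -x) (fun y hy => by
            rw [mem_ball_zero_iff, ← sub_eq_add_neg, ← dist_eq_norm, two_mul]
            exact (dist_triangle_right y x x₀).trans_lt (add_lt_add hy hx))
        refine le_trans (le_of_eq ?_) this
        refine lintegral_congr fun y => ?_
        rw [add_comm y, add_neg_cancel_left, enorm_sub_rev]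
    _ = ∫⁻ v in Q, ∫⁻ x in B, ‖φ (x + v) - φ x‖ₑ ^ 2 ∂μ ∂μ :=
        lintegral_lintegral_swap hm₂.aemeasurable
    _ ≤ ∫⁻ v in Q, ENNReal.ofReal (2 * η) ^ 2 * J ∂μ := by
        refine setLIntegral_mono measurable_const fun v hv => ?_
        have hvn : ‖v‖ < 2 * η := mem_ball_zero_iff.1 hv
        refine (lintegral_shift_sub_sq_le μ hφ hD ?_).trans ?_
        · intro x hx s hs
          refine h ?_
          rw [Metric.mem_ball, dist_eq_norm] at hx ⊢
          calc ‖x + s • v - x₀‖ = ‖(x - x₀) + s • v‖ := by congr 1; abel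
            _ ≤ ‖x - x₀‖ + s * ‖v‖ := (norm_add_le _ _).trans_eq (by
                rw [norm_smul, Real.norm_of_nonneg hs.1.le])
            _ < η + 2 * η := add_lt_add_of_lt_of_le hx
                ((mul_le_of_le_one_left (norm_nonneg v) hs.2).trans hvn.le)
            _ = 3 * η := by ring
        · gcongr
          rw [← ofReal_norm]
          exact ENNReal.ofReal_le_ofReal hvn.le
    _ = ENNReal.ofReal (2 * η) ^ 2 * μ Q * J := by
        rw [setLIntegral_const]; ring

end Poincare

namespace Geometry

open scoped ENNReal

variable {d M : ℕ} (G : Geometry d M)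

theorem orthogonalProjectionOnto_add_smul {E : Type*} [NormedAddCommGroup E]
    [InnerProductSpace ℝ E] (e x : E) (s : ℝ) :
    (ℝ ∙ e)ᗮ.orthogonalProjectionOnto (x + s • e) = (ℝ ∙ e)ᗮ.orthogonalProjectionOnto x := by
  have h : (ℝ ∙ e)ᗮ.orthogonalProjectionOnto e = 0 :=
    Submodule.orthogonalProjectionOnto_eq_zero_iff.2
      (Submodule.le_orthogonal_orthogonal _ (Submodule.mem_span_singleton_self e))
  rw [map_add, map_smul, h, smul_zero, add_zero]

theorem inner_add_smul_self {E : Type*} [NormedAddCommGroup E]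
    [InnerProductSpace ℝ E] {e : E} (he : ‖e‖ = 1) (x : E) (s : ℝ) :
    ⟪e, x + s • e⟫_ℝ = ⟪e, x⟫_ℝ + s := by
  rw [inner_add_right, inner_smul_right, real_inner_self_eq_norm_sq, he]
  ring

/-- Near a boundary point, the boundary is a Lipschitz graph, and the domain is invariant under
small shifts in the direction of the last coordinate axis. -/
theorem exists_boundary_chart {x₀ : EuclideanSpace ℝ (Fin d)} (hx₀ : x₀ ∈ frontier G.D) :
    ∃ (e : EuclideanSpace ℝ (Fin d)) (r : ℝ) (K : ℝ≥0) (ψ : (ℝ ∙ e)ᗮ → ℝ), ‖e‖ = 1 ∧ 0 < r ∧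
      LipschitzWith K ψ ∧
      (∀ x ∈ frontier G.D ∩ Metric.ball x₀ r,
        ψ ((ℝ ∙ e)ᗮ.orthogonalProjectionOnto x) = ⟪e, x⟫_ℝ) ∧
      ∀ x ∈ closure G.D ∩ Metric.ball x₀ r, ∀ s : ℝ, 0 < s → x + s • e ∈ Metric.ball x₀ r →
        x + s • e ∈ G.D := by
  obtain ⟨e, r, K, ψ, he, hr, hψ, hD⟩ := G.lipschitz_D x₀ hx₀
  set P := (ℝ ∙ e)ᗮ.orthogonalProjectionOnto
  have hge : ∀ x ∈ closure G.D ∩ Metric.ball x₀ r, ψ (P x) ≤ ⟪e, x⟫_ℝ := by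
    rintro x ⟨hx, hxr⟩
    have hcl : IsClosed {z | ψ (P z) ≤ ⟪e, z⟫_ℝ} :=
      isClosed_le (hψ.continuous.comp P.continuous) (continuous_const.inner continuous_id)
    have hmem : x ∈ closure (G.D ∩ Metric.ball x₀ r) := by
      rw [inter_comm]
      exact Metric.isOpen_ball.inter_closure ⟨hxr, hx⟩
    refine closure_minimal ?_ hcl hmem
    rintro z ⟨hz, hzr⟩
    exact ((hD z hzr).1 hz).le
  refine ⟨e, r, K, ψ, he, hr, hψ, ?_, ?_⟩
  · rintro x ⟨hx, hxr⟩
    refine le_antisymm (hge x ⟨frontier_subset_closure hx, hxr⟩) ?_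
    by_contra! hlt
    have hxD : x ∈ G.D := (hD x hxr).2 hlt
    rw [G.isOpen_D.frontier_eq] at hx
    exact hx.2 hxD
  · intro x hx s hs hxs
    rw [hD _ hxs, orthogonalProjectionOnto_add_smul, inner_add_smul_self he]
    exact (hge x hx).trans_lt (lt_add_of_pos_right _ hs)

theorem isCompact_closure_D : IsCompact (closure G.D) := G.isBounded_D.isCompact_closure

/-- An interior point has a ball to itself. A piece of `D` near a boundary point is moved by `(r /
2) • e` into a ball inside `D`. -/
theorem poincareOn_D : PoincareOn volume G.D G.D := by
  refine poincareOn_self_of_local G.isOpen_D G.isConnected_D G.isCompact_closure_D fun x₀ hx₀ => ?_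
  by_cases hxD : x₀ ∈ G.D
  · obtain ⟨ε, hε, hball⟩ := Metric.isOpen_iff.1 G.isOpen_D x₀ hxD
    refine ⟨ε / 3, by positivity, PoincareOn.mono ?_ inter_subset_right⟩
    exact poincareOn_ball G.isOpen_D.measurableSet (by positivity) (by
      rwa [mul_div_cancel₀ ε three_ne_zero])
  have hfr : x₀ ∈ frontier G.D := by
    rw [G.isOpen_D.frontier_eq]
    exact ⟨hx₀, hxD⟩
  obtain ⟨e, r, K, ψ, he, hr, -, -, hshift⟩ := G.exists_boundary_chart hfr
  have hnorm : ∀ s : ℝ, 0 < s → ‖s • e‖ = s := fun s hs => by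
    rw [norm_smul, he, mul_one, Real.norm_of_nonneg hs.le]
  have hmem : x₀ + (r / 2) • e ∈ G.D := by
    refine hshift x₀ ⟨hx₀, Metric.mem_ball_self hr⟩ _ (by positivity) ?_
    rw [Metric.mem_ball, dist_eq_norm, add_sub_cancel_left, hnorm _ (by positivity)]
    linarith
  obtain ⟨ε, hε, hball⟩ := Metric.isOpen_iff.1 G.isOpen_D _ hmem
  -- `3 * η ≤ ε` is what the inequality on the shifted ball needs; `η ≤ r / 2` keeps the shift
  -- inside the chart of radius `r`.
  set η := min (ε / 3) (r / 2) with hη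
  have hη0 : 0 < η := lt_min (by positivity) (by positivity)
  have hη1 : 3 * η ≤ ε := by
    have := min_le_left (ε / 3) (r / 2)
    linarith
  have hη2 : η ≤ r / 2 := min_le_right _ _
  have hP := poincareOn_ball (μ := volume) G.isOpen_D.measurableSet hη0
    ((Metric.ball_subset_ball hη1).trans hball)
  refine ⟨η, hη0, hP.of_shift G.isOpen_D.measurableSet Metric.isOpen_ball.measurableSet
    (v := (r / 2) • e) ?_ ?_⟩
  · rintro x ⟨-, hx⟩
    simpa using hx
  · rintro x ⟨hxD, hx⟩ s hs
    rw [Metric.mem_ball, dist_eq_norm] at hx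
    rw [smul_smul]
    refine hshift x ⟨subset_closure hxD, ?_⟩ _ (mul_pos hs.1 (by positivity)) ?_
    · rw [Metric.mem_ball, dist_eq_norm]
      linarith
    · rw [Metric.mem_ball, dist_eq_norm]
      calc ‖x + (s * (r / 2)) • e - x₀‖ = ‖(x - x₀) + (s * (r / 2)) • e‖ := by congr 1; abel
        _ ≤ ‖x - x₀‖ + s * (r / 2) := (norm_add_le _ _).trans_eq (by
            rw [hnorm _ (mul_pos hs.1 (by positivity))])
        _ < r / 2 + 1 * (r / 2) := add_lt_add_of_lt_of_le (hx.trans_le hη2) (by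
            gcongr; exact hs.2)
        _ = r := by ring

/-! ### The trace inequality -/

theorem finrank_orthogonal_span_of_norm_one {e : EuclideanSpace ℝ (Fin d)} (he : ‖e‖ = 1) :
    Module.finrank ℝ (ℝ ∙ e)ᗮ = d - 1 := by
  have he0 : e ≠ 0 := by rintro rfl; simp at he
  have h1 := (ℝ ∙ e).finrank_add_finrank_orthogonal
  rw [finrank_span_singleton he0, finrank_euclideanSpace_fin] at h1
  omega

/-- Lebesgue measure in Cartesian coordinates with last coordinate axis in the direction `e`, up
to a factor. -/
theorem lintegral_orthogonal_prod {e : EuclideanSpace ℝ (Fin d)} (he : ‖e‖ = 1) {h : ℝ}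
    (hh : 0 < h) (lam : Measure (ℝ ∙ e)ᗮ) [lam.IsAddHaarMeasure] :
    ∃ C : ℝ≥0, ∀ F : EuclideanSpace ℝ (Fin d) → ℝ≥0∞, Measurable F →
      ∫⁻ w : (ℝ ∙ e)ᗮ, (∫⁻ s : ℝ, F (w + s • h • e)) ∂lam = C * ∫⁻ x, F x := by
  set P := (ℝ ∙ e)ᗮ.orthogonalProjectionOnto
  let f : ((ℝ ∙ e)ᗮ × ℝ) →L[ℝ] EuclideanSpace ℝ (Fin d) :=
    (ℝ ∙ e)ᗮ.subtypeL.coprod ((1 : ℝ →L[ℝ] ℝ).smulRight (h • e))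
  let g : EuclideanSpace ℝ (Fin d) →L[ℝ] ((ℝ ∙ e)ᗮ × ℝ) := P.prod (h⁻¹ • innerSL ℝ e)
  have hf : ∀ p, f p = p.1 + p.2 • h • e := fun p => by simp [f]
  have hg : ∀ x, g x = (P x, h⁻¹ * ⟪e, x⟫_ℝ) := fun x => by simp [g]
  have hgf : Function.LeftInverse g f := by
    rintro ⟨w, s⟩
    rw [hg, hf, smul_smul, orthogonalProjectionOnto_add_smul, inner_add_smul_self he,
      Submodule.orthogonalProjectionOnto_mem_subspace_eq_self,
      Submodule.mem_orthogonal_singleton_iff_inner_right.1 w.2]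
    rw [zero_add, mul_comm s, inv_mul_cancel_left₀ hh.ne']
  have hfg : Function.RightInverse g f := by
    intro x
    rw [hg, hf]
    have h2 := (ℝ ∙ e).starProjection_add_starProjection_orthogonal x
    rw [Submodule.starProjection_unit_singleton ℝ he, add_comm] at h2
    rw [smul_smul, mul_right_comm, inv_mul_cancel₀ hh.ne', one_mul]
    exact h2
  let L := ContinuousLinearEquiv.equivOfInverse f g hgf hfg
  have hL : ∀ p, L p = p.1 + p.2 • h • e := hf
  -- The image of the product measure under a linear isomorphism is translation invariant, hence a
  -- multiple of Lebesgue measure.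
  obtain ⟨c, hc⟩ : ∃ c : ℝ≥0, (lam.prod volume).map L = c • volume :=
    ⟨_, Measure.isAddLeftInvariant_eq_smul ((lam.prod volume).map L) volume⟩
  refine ⟨c, fun F hF => ?_⟩
  have hmeas : Measurable fun p : (ℝ ∙ e)ᗮ × ℝ => F (p.1 + p.2 • h • e) := by
    have : Continuous fun p : (ℝ ∙ e)ᗮ × ℝ => (p.1 : EuclideanSpace ℝ (Fin d)) + p.2 • h • e := by
      fun_prop
    exact hF.comp this.measurable
  calc ∫⁻ w : (ℝ ∙ e)ᗮ, (∫⁻ s : ℝ, F (w + s • h • e)) ∂lam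
      = ∫⁻ p, F (L p) ∂(lam.prod volume) := by
        simp_rw [hL]
        exact (lintegral_prod _ hmeas.aemeasurable).symm
    _ = ∫⁻ x, F x ∂((lam.prod volume).map L) :=
        (lintegral_map hF L.continuous.measurable).symm
    _ = _ := by rw [hc, lintegral_smul_measure]; rfl

/-- On a part of the boundary that is a Lipschitz graph, surface measure is controlled by the
measure of the projection. -/
theorem surf_restrict_le {e : EuclideanSpace ℝ (Fin d)} (he : ‖e‖ = 1) {K : ℝ≥0}
    {ψ : (ℝ ∙ e)ᗮ → ℝ} (hψ : LipschitzWith K ψ) {B : Set (EuclideanSpace ℝ (Fin d))}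
    (hB : MeasurableSet B)
    (hgraph : ∀ x ∈ frontier G.D ∩ B, ψ ((ℝ ∙ e)ᗮ.orthogonalProjectionOnto x) = ⟪e, x⟫_ℝ) :
    ∃ C : ℝ≥0∞, C ≠ ⊤ ∧ G.surf.restrict B ≤
      C • (Measure.hausdorffMeasure (Module.finrank ℝ (ℝ ∙ e)ᗮ) : Measure (ℝ ∙ e)ᗮ).map
        (fun w : (ℝ ∙ e)ᗮ => (w : EuclideanSpace ℝ (Fin d)) + ψ w • e) := by
  set P := (ℝ ∙ e)ᗮ.orthogonalProjectionOnto
  set γ : (ℝ ∙ e)ᗮ → EuclideanSpace ℝ (Fin d) := fun w => (w : EuclideanSpace ℝ (Fin d)) + ψ w • e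
  have hlip : LipschitzWith (1 + K) γ := by
    refine LipschitzWith.add ?_ ?_
    · exact LipschitzWith.of_dist_le_mul (fun x y => by simp [Subtype.dist_eq])
    · refine LipschitzWith.of_dist_le_mul (fun x y => ?_)
      rw [dist_eq_norm, ← sub_smul, norm_smul, he, mul_one]
      simpa [Real.dist_eq] using hψ.dist_le_mul x y
  have hγP : ∀ x ∈ frontier G.D ∩ B, γ (P x) = x := by
    intro x hx
    change (P x : EuclideanSpace ℝ (Fin d)) + ψ (P x) • e = x
    rw [hgraph x hx]
    have h2 := (ℝ ∙ e).starProjection_add_starProjection_orthogonal x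
    rw [Submodule.starProjection_unit_singleton ℝ he] at h2
    rw [add_comm]
    exact h2
  obtain ⟨c, hc⟩ : ∃ c : ℝ≥0, (Measure.euclideanHausdorffMeasure (d - 1) :
      Measure (EuclideanSpace ℝ (Fin d))) = c • Measure.hausdorffMeasure ((d - 1 : ℕ) : ℝ) :=
    ⟨_, Measure.euclideanHausdorffMeasure_def ..⟩
  set n : ℝ := ((Module.finrank ℝ (ℝ ∙ e)ᗮ : ℕ) : ℝ) with hn
  have hn0 : 0 ≤ n := by positivity
  refine ⟨c * ((1 + K : ℝ≥0) : ℝ≥0∞) ^ n, ENNReal.mul_ne_top ENNReal.coe_ne_top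
    (ENNReal.rpow_ne_top_of_nonneg hn0 ENNReal.coe_ne_top), Measure.le_iff.2 fun A hA => ?_⟩
  rw [Measure.restrict_apply hA, surf, Measure.restrict_apply (hA.inter hB), hc,
    Measure.smul_apply, Measure.smul_apply, Measure.map_apply hlip.continuous.measurable hA,
    ← finrank_orthogonal_span_of_norm_one he, ← hn, ENNReal.smul_def, smul_eq_mul, smul_eq_mul,
    mul_assoc]
  refine mul_le_mul_right ?_ _
  -- Inside `B` the boundary lies on the graph, so it is covered by the image of `γ`, which enlarges
  -- `n`-dimensional Hausdorff measure by at most the factor `(1 + K) ^ n`.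
  have hsub : A ∩ B ∩ frontier G.D ⊆ γ '' (γ ⁻¹' A) := by
    rintro x ⟨⟨hxA, hxB⟩, hx⟩
    have h := hγP x ⟨hx, hxB⟩
    exact ⟨P x, by rw [mem_preimage, h]; exact hxA, h⟩
  exact (measure_mono hsub).trans (hlip.hausdorffMeasure_image_le hn0 _)

/-- The trace inequality near a boundary point. -/
theorem exists_local_trace_inequality {x₀ : EuclideanSpace ℝ (Fin d)} (hx₀ : x₀ ∈ frontier G.D) :
    ∃ r > 0, ∃ C : ℝ≥0∞, C ≠ ⊤ ∧ ∀ φ : EuclideanSpace ℝ (Fin d) → ℝ, ContDiff ℝ 1 φ →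
      ∫⁻ x in Metric.ball x₀ r, ‖φ x‖ₑ ^ 2 ∂G.surf ≤
        C * ((∫⁻ x in G.D, ‖φ x‖ₑ ^ 2) + ∫⁻ x in G.D, ‖fderiv ℝ φ x‖ₑ ^ 2) := by
  obtain ⟨e, r, K, ψ, he, hr, hψ, hgraph, hshift⟩ := G.exists_boundary_chart hx₀
  set B := Metric.ball x₀ (r / 2)
  have hBr : B ⊆ Metric.ball x₀ r := Metric.ball_subset_ball (by linarith)
  have hh : 0 < r / 2 := by positivity
  set h := r / 2
  set v := h • e with hv
  obtain ⟨C₁, hC₁, hle⟩ := G.surf_restrict_le he hψ Metric.isOpen_ball.measurableSet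
    (B := B) (fun x hx => hgraph x ⟨hx.1, hBr hx.2⟩)
  obtain ⟨C₂, hC₂⟩ := lintegral_orthogonal_prod he hh
    (Measure.hausdorffMeasure (Module.finrank ℝ (ℝ ∙ e)ᗮ) : Measure (ℝ ∙ e)ᗮ)
  set lam : Measure (ℝ ∙ e)ᗮ := Measure.hausdorffMeasure (Module.finrank ℝ (ℝ ∙ e)ᗮ)
  set m := G.surf.restrict B
  have hmem : ∀ᵐ p ∂m, p ∈ frontier G.D ∩ B := by
    refine (ae_restrict_of_ae (ae_restrict_mem isClosed_frontier.measurableSet)).and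
      (ae_restrict_mem Metric.isOpen_ball.measurableSet)
  have hD : ∀ p ∈ frontier G.D ∩ B, ∀ s ∈ Ioc (0 : ℝ) 1, p + s • v ∈ G.D := by
    rintro p ⟨hp, hpB⟩ s hs
    rw [hv, smul_smul]
    refine hshift p ⟨frontier_subset_closure hp, hBr hpB⟩ _ (mul_pos hs.1 hh) ?_
    rw [Metric.mem_ball, dist_eq_norm] at hpB ⊢
    calc ‖p + (s * h) • e - x₀‖ = ‖(p - x₀) + (s * h) • e‖ := by congr 1; abel
      _ ≤ ‖p - x₀‖ + s * h := (norm_add_le _ _).trans_eq (by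
          rw [norm_smul, he, mul_one, Real.norm_of_nonneg (mul_pos hs.1 hh).le])
      _ < h + 1 * h := add_lt_add_of_lt_of_le hpB (by gcongr; exact hs.2)
      _ = r := by simp only [h]; ring
  -- Integrating over the boundary piece and over shifts in the direction `v` is controlled by the
  -- volume integral over `D`.
  have hlayer : ∀ f : EuclideanSpace ℝ (Fin d) → ℝ≥0∞, Measurable f →
      ∫⁻ p, (∫⁻ s in Ioc (0 : ℝ) 1, f (p + s • v)) ∂m ≤ C₁ * C₂ * ∫⁻ x in G.D, f x := by
    intro f hf
    set F := G.D.indicator f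
    have hF : Measurable F := hf.indicator G.isOpen_D.measurableSet
    have hFm : Measurable fun p : EuclideanSpace ℝ (Fin d) × ℝ => F (p.1 + p.2 • v) :=
      hF.comp (Continuous.measurable (by fun_prop))
    set Φ : EuclideanSpace ℝ (Fin d) → ℝ≥0∞ := fun p => ∫⁻ s in Ioc (0 : ℝ) 1, F (p + s • v)
    have hΦ : Measurable Φ := hFm.lintegral_prod_right'
    have hγ : Continuous fun w : (ℝ ∙ e)ᗮ => (w : EuclideanSpace ℝ (Fin d)) + ψ w • e := by
      have := hψ.continuous
      fun_prop
    calc ∫⁻ p, (∫⁻ s in Ioc (0 : ℝ) 1, f (p + s • v)) ∂m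
        ≤ ∫⁻ p, Φ p ∂m := by
          refine lintegral_mono_ae ?_
          filter_upwards [hmem] with p hp
          refine setLIntegral_mono (hFm.comp measurable_prodMk_left) fun s hs => ?_
          exact (indicator_of_mem (hD p hp s hs) f).ge
      _ ≤ C₁ * ∫⁻ w : (ℝ ∙ e)ᗮ, Φ (w + ψ w • e) ∂lam := by
          refine (lintegral_mono' hle le_rfl).trans_eq ?_
          rw [lintegral_smul_measure, lintegral_map hΦ hγ.measurable, smul_eq_mul]
      _ ≤ C₁ * ∫⁻ w : (ℝ ∙ e)ᗮ, (∫⁻ s : ℝ, F (w + s • v)) ∂lam := by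
          gcongr with w
          refine (setLIntegral_le_lintegral _ _).trans_eq ?_
          -- The height `ψ w` of the graph is a translation of the variable `s` and disappears once
          -- the integral runs over the whole line.
          rw [← lintegral_add_left_eq_self (fun s : ℝ => F (w + s • v)) (ψ w / h)]
          refine lintegral_congr fun s => ?_
          rw [add_smul, hv, smul_smul (ψ w / h), div_mul_cancel₀ _ hh.ne', add_assoc]
      _ = C₁ * C₂ * ∫⁻ x in G.D, f x := by
          rw [hC₂ F hF, lintegral_indicator G.isOpen_D.measurableSet, mul_assoc]
  refine ⟨h, hh, 2 * ((1 + ‖v‖ₑ ^ 2) * (C₁ * C₂)), by finiteness, fun φ hφ => ?_⟩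
  have hφc := hφ.continuous
  have hm₁ : Measurable fun x => ‖φ x‖ₑ ^ 2 := hφc.enorm.measurable.pow_const 2
  have hm₂ : Measurable fun x => ‖fderiv ℝ φ x‖ₑ ^ 2 :=
    (hφ.continuous_fderiv one_ne_zero).enorm.measurable.pow_const 2
  set J₁ := ∫⁻ x in G.D, ‖φ x‖ₑ ^ 2
  set J₂ := ∫⁻ x in G.D, ‖fderiv ℝ φ x‖ₑ ^ 2
  have hline : ∀ p : EuclideanSpace ℝ (Fin d), Measurable fun s : ℝ => p + s • v := fun p =>
    Continuous.measurable (by fun_prop)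
  have hm₃ : Measurable fun p => ∫⁻ s in Ioc (0 : ℝ) 1, ‖φ (p + s • v)‖ₑ ^ 2 :=
    (hm₁.comp (g := fun x => ‖φ x‖ₑ ^ 2) (f := fun p : EuclideanSpace ℝ (Fin d) × ℝ =>
      p.1 + p.2 • v) (Continuous.measurable (by fun_prop))).lintegral_prod_right'
  -- The value at `p` is compared with the values at `p + s • v` and averaged over `s`, which turns
  -- a boundary value into integrals over the layer.
  have hpoint : ∀ p : EuclideanSpace ℝ (Fin d), ‖φ p‖ₑ ^ 2 ≤
      2 * ((∫⁻ s in Ioc (0 : ℝ) 1, ‖φ (p + s • v)‖ₑ ^ 2) +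
        ‖v‖ₑ ^ 2 * ∫⁻ s in Ioc (0 : ℝ) 1, ‖fderiv ℝ φ (p + s • v)‖ₑ ^ 2) := by
    intro p
    set T := ‖v‖ₑ ^ 2 * ∫⁻ s in Ioc (0 : ℝ) 1, ‖fderiv ℝ φ (p + s • v)‖ₑ ^ 2
    have hms : Measurable fun s : ℝ => ‖φ (p + s • v)‖ₑ ^ 2 := hm₁.comp (hline p)
    calc ‖φ p‖ₑ ^ 2 = ∫⁻ s in Ioc (0 : ℝ) 1, ‖φ p‖ₑ ^ 2 := by simp
      _ ≤ ∫⁻ s in Ioc (0 : ℝ) 1, 2 * (‖φ (p + s • v)‖ₑ ^ 2 + T) := by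
          refine setLIntegral_mono ((hms.add_const T).const_mul 2) fun s hs => ?_
          have h1 := enorm_sub_sq_le (φ p) (φ (p + s • v)) 0
          rw [sub_zero, sub_zero, enorm_sub_rev, add_comm] at h1
          refine h1.trans ?_
          gcongr
          exact enorm_sub_sq_le_lintegral_fderiv hφ p v hs
      _ = _ := by
          rw [lintegral_const_mul' _ _ (by finiteness), lintegral_add_left hms]
          simp
  calc ∫⁻ p, ‖φ p‖ₑ ^ 2 ∂m ≤ ∫⁻ p, (2 * ((∫⁻ s in Ioc (0 : ℝ) 1, ‖φ (p + s • v)‖ₑ ^ 2) +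
        ‖v‖ₑ ^ 2 * ∫⁻ s in Ioc (0 : ℝ) 1, ‖fderiv ℝ φ (p + s • v)‖ₑ ^ 2)) ∂m :=
        lintegral_mono hpoint
    _ = 2 * ((∫⁻ p, (∫⁻ s in Ioc (0 : ℝ) 1, ‖φ (p + s • v)‖ₑ ^ 2) ∂m) +
        ‖v‖ₑ ^ 2 * ∫⁻ p, (∫⁻ s in Ioc (0 : ℝ) 1, ‖fderiv ℝ φ (p + s • v)‖ₑ ^ 2) ∂m) := by
        rw [lintegral_const_mul' _ _ (by finiteness), lintegral_add_left hm₃,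
          lintegral_const_mul' _ _ (by finiteness)]
    _ ≤ 2 * (C₁ * C₂ * J₁ + ‖v‖ₑ ^ 2 * (C₁ * C₂ * J₂)) := by
        gcongr
        · exact hlayer _ hm₁
        · exact hlayer _ hm₂
    _ ≤ 2 * ((1 + ‖v‖ₑ ^ 2) * (C₁ * C₂) * J₁ + (1 + ‖v‖ₑ ^ 2) * (C₁ * C₂) * J₂) := by
        rw [← mul_assoc (‖v‖ₑ ^ 2)]
        have h1 : C₁ * C₂ ≤ (1 + ‖v‖ₑ ^ 2) * (C₁ * C₂) := le_mul_of_one_le_left' le_self_add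
        have h2 : ‖v‖ₑ ^ 2 * (C₁ * C₂) ≤ (1 + ‖v‖ₑ ^ 2) * (C₁ * C₂) :=
          mul_le_mul_left le_add_self _
        gcongr
    _ = _ := by ring

/-- The trace inequality. -/
theorem exists_trace_inequality :
    ∃ C : ℝ≥0∞, C ≠ ⊤ ∧ ∀ φ : EuclideanSpace ℝ (Fin d) → ℝ, ContDiff ℝ 1 φ →
      ∫⁻ x, ‖φ x‖ₑ ^ 2 ∂G.surf ≤
        C * ((∫⁻ x in G.D, ‖φ x‖ₑ ^ 2) + ∫⁻ x in G.D, ‖fderiv ℝ φ x‖ₑ ^ 2) := by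
  have hcomp : IsCompact (frontier G.D) :=
    G.isCompact_closure_D.of_isClosed_subset isClosed_frontier frontier_subset_closure
  have key := hcomp.induction_on (p := fun S => ∃ C : ℝ≥0∞, C ≠ ⊤ ∧
    ∀ φ : EuclideanSpace ℝ (Fin d) → ℝ, ContDiff ℝ 1 φ → ∫⁻ x in S, ‖φ x‖ₑ ^ 2 ∂G.surf ≤
      C * ((∫⁻ x in G.D, ‖φ x‖ₑ ^ 2) + ∫⁻ x in G.D, ‖fderiv ℝ φ x‖ₑ ^ 2))
    ⟨0, by simp, by simp⟩
    (fun s t hst ⟨C, hC, h⟩ => ⟨C, hC, fun φ hφ => (lintegral_mono_set hst).trans (h φ hφ)⟩)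
    (fun s t ⟨C, hC, h⟩ ⟨C', hC', h'⟩ => ⟨C + C', by finiteness, fun φ hφ => by
      rw [add_mul]
      exact (lintegral_union_le _ _ _).trans (add_le_add (h φ hφ) (h' φ hφ))⟩)
    (fun x hx => by
      obtain ⟨r, hr, h⟩ := G.exists_local_trace_inequality hx
      exact ⟨_, mem_nhdsWithin_of_mem_nhds (Metric.ball_mem_nhds x hr), h⟩)
  have hres : G.surf.restrict (frontier G.D) = G.surf := by
    rw [surf, Measure.restrict_restrict isClosed_frontier.measurableSet, inter_self]
  rwa [hres] at key

end Geometry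

/-! ### Closedness of the range of the energy map -/

theorem enorm_sq_Lp_two {α F : Type*} [MeasurableSpace α] {μ : Measure α} [NormedAddCommGroup F]
    (f : Lp F 2 μ) : ‖f‖ₑ ^ 2 = ∫⁻ x, ‖f x‖ₑ ^ 2 ∂μ := by
  rw [Lp.enorm_def, eLpNorm_eq_lintegral_rpow_enorm_toReal two_ne_zero ENNReal.ofNat_ne_top,
    ← ENNReal.rpow_two, ← ENNReal.rpow_mul]
  norm_num

namespace Geometry

open scoped ENNReal

variable {d M : ℕ} (G : Geometry d M)

/-- The space of the triples (function, gradient, trace). -/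
abbrev TripleSpace : Type :=
  Lp ℝ 2 G.vol × Lp (EuclideanSpace ℝ (Fin d)) 2 G.vol × Lp ℝ 2 G.surf

/-- The triple of the constant function `1`. -/
def oneTriple : G.TripleSpace := (Lp.const 2 G.vol 1, 0, Lp.const 2 G.surf 1)

theorem oneTriple_mem : G.oneTriple ∈ G.smoothGraph := by
  refine ⟨fun _ => 1, contDiff_const, Lp.coeFn_const _ _ _, ?_, Lp.coeFn_const _ _ _⟩
  filter_upwards [Lp.coeFn_zero (EuclideanSpace ℝ (Fin d)) 2 G.vol] with x hx
  exact hx.trans (gradient_const x (1 : ℝ)).symm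

/-- For a fixed test function both sides of the defining identity are `L²` inner products with fixed
elements, hence continuous. -/
theorem isClosed_hasWeakGradient :
    IsClosed {p : Lp ℝ 2 G.vol × Lp (EuclideanSpace ℝ (Fin d)) 2 G.vol |
      G.HasWeakGradient p.1 p.2} := by
  simp only [HasWeakGradient, ofPred_forall]
  refine isClosed_iInter fun φ => isClosed_iInter fun hφ => isClosed_iInter fun hc =>
    isClosed_iInter fun _ => isClosed_iInter fun i => ?_
  have hm₁ : MemLp (fun x => fderiv ℝ φ x (EuclideanSpace.single i 1)) 2 G.vol :=
    (((hφ.continuous_fderiv (by simp)).clm_apply continuous_const).memLp_of_hasCompactSupport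
      (hc.fderiv_apply ℝ _) : MemLp _ 2 volume).restrict G.D
  have hm₂ : MemLp (fun x => φ x • (EuclideanSpace.single i 1 : EuclideanSpace ℝ (Fin d))) 2
      G.vol :=
    ((hφ.continuous.smul continuous_const).memLp_of_hasCompactSupport
      (hc.smul_right) : MemLp _ 2 volume).restrict G.D
  have h₁ : ∀ v : Lp ℝ 2 G.vol, ∫ x in G.D, v x * fderiv ℝ φ x (EuclideanSpace.single i 1) =
      ⟪hm₁.toLp _, v⟫_ℝ := by
    intro v
    rw [L2.inner_def]
    refine integral_congr_ae ?_
    filter_upwards [hm₁.coeFn_toLp] with x hx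
    rw [hx]
    simp
  have h₂ : ∀ g : Lp (EuclideanSpace ℝ (Fin d)) 2 G.vol, ∫ x in G.D, g x i * φ x =
      ⟪hm₂.toLp _, g⟫_ℝ := by
    intro g
    rw [L2.inner_def]
    refine integral_congr_ae ?_
    filter_upwards [hm₂.coeFn_toLp] with x hx
    rw [hx, inner_smul_left, EuclideanSpace.inner_single_left]
    simp [mul_comm]
  simp only [h₁, h₂]
  exact isClosed_eq (continuous_const.inner continuous_fst)
    (continuous_const.inner continuous_snd).neg

theorem hasWeakGradient_of_mem_smoothGraph {p : G.TripleSpace} (hp : p ∈ G.smoothGraph) :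
    G.HasWeakGradient p.1 p.2.1 := by
  obtain ⟨φ, hφ, h1, h2, -⟩ := hp
  intro χ hχ hc hs i
  have hφd : Continuous fun x => fderiv ℝ φ x (EuclideanSpace.single i 1) :=
    (hφ.continuous_fderiv (by simp)).clm_apply continuous_const
  have hχd : Continuous fun x => fderiv ℝ χ x (EuclideanSpace.single i 1) :=
    (hχ.continuous_fderiv (by simp)).clm_apply continuous_const
  have hcd : HasCompactSupport fun x => fderiv ℝ χ x (EuclideanSpace.single i 1) :=
    hc.fderiv_apply ℝ _
  have hzero : ∀ x ∉ G.D, χ x = 0 := fun x hx => by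
    by_contra h
    exact hx (hs (subset_tsupport _ h))
  have hzero' : ∀ x ∉ G.D, fderiv ℝ χ x (EuclideanSpace.single i 1) = 0 := fun x hx => by
    have : fderiv ℝ χ x = 0 := by
      by_contra h
      exact hx (hs (support_fderiv_subset ℝ (f := χ) (Function.mem_support.2 h)))
    rw [this]
    rfl
  have e1 : ∫ x in G.D, p.1 x * fderiv ℝ χ x (EuclideanSpace.single i 1) =
      ∫ x, φ x * fderiv ℝ χ x (EuclideanSpace.single i 1) := by
    refine Eq.trans (integral_congr_ae ?_) (setIntegral_eq_integral_of_forall_compl_eq_zero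
      (s := G.D) (fun x hx => by rw [hzero' x hx, mul_zero]))
    filter_upwards [h1] with x hx
    rw [hx]
  have e2 : ∫ x in G.D, p.2.1 x i * χ x =
      ∫ x, fderiv ℝ φ x (EuclideanSpace.single i 1) * χ x := by
    refine Eq.trans (integral_congr_ae ?_) (setIntegral_eq_integral_of_forall_compl_eq_zero
      (s := G.D) (fun x hx => by rw [hzero x hx, mul_zero]))
    filter_upwards [h2] with x hx
    have : gradient φ x i = fderiv ℝ φ x (EuclideanSpace.single i 1) := by
      have h := InnerProductSpace.toDual_symm_apply (𝕜 := ℝ)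
        (x := (EuclideanSpace.single i 1 : EuclideanSpace ℝ (Fin d))) (y := fderiv ℝ φ x)
      rw [EuclideanSpace.inner_single_right] at h
      simpa [gradient] using h
    rw [hx, this]
  rw [e1, e2]
  exact integral_mul_fderiv_eq_neg_fderiv_mul_of_integrable
    ((hφd.mul hχ.continuous).integrable_of_hasCompactSupport hc.mul_left)
    ((hφ.continuous.mul hχd).integrable_of_hasCompactSupport hcd.mul_left)
    ((hφ.continuous.mul hχ.continuous).integrable_of_hasCompactSupport hc.mul_left)
    (fun x _ => hφ.differentiable (by simp) x) (fun x _ => hχ.differentiable (by simp) x)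

theorem hasWeakGradient_of_mem_closure {p : G.TripleSpace}
    (hp : p ∈ G.smoothGraph.topologicalClosure) : G.HasWeakGradient p.1 p.2.1 := by
  have hcl : IsClosed {p : G.TripleSpace | G.HasWeakGradient p.1 p.2.1} :=
    G.isClosed_hasWeakGradient.preimage (f := fun p : G.TripleSpace => (p.1, p.2.1)) (by fun_prop)
  exact closure_minimal (fun q hq => G.hasWeakGradient_of_mem_smoothGraph hq) hcl hp

/-- The element of `H¹(D)` with trace that a triple in the closure of the smooth triples stands
for. -/
def traceOfMem {p : G.TripleSpace} (hp : p ∈ G.smoothGraph.topologicalClosure) : G.H1Trace :=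
  ⟨(⟨(p.1, p.2.1), G.hasWeakGradient_of_mem_closure hp⟩, p.2.2), hp⟩

/-- The Poincaré inequality, with trace, for smooth functions. -/
theorem exists_poincare_smooth : ∃ C : ℝ, 0 ≤ C ∧ ∀ p ∈ G.smoothGraph, ∃ c : ℝ,
    ‖p - c • G.oneTriple‖ ≤ C * ‖p.2.1‖ := by
  obtain ⟨C₁, hC₁, hP⟩ := G.poincareOn_D
  obtain ⟨C₂, hC₂, hT⟩ := G.exists_trace_inequality
  -- The summands serve the gradient, the function (Poincaré) and the trace (trace inequality, then
  -- Poincaré). The bounds are for squares, hence the root below.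
  set C : ℝ≥0∞ := 1 + C₁ + C₂ * (C₁ + 1) with hC
  have hCtop : C ≠ ⊤ := by finiteness
  refine ⟨√C.toReal, Real.sqrt_nonneg _, ?_⟩
  rintro p ⟨φ, hφ, h1, h2, h3⟩
  have hφ1 : ContDiff ℝ 1 φ := hφ.of_le (by exact_mod_cast le_top)
  obtain ⟨c, hc⟩ := hP φ hφ1
  have hc' := hT (fun x => φ x - c) (hφ1.sub contDiff_const)
  have hfd : ∀ x, fderiv ℝ (fun x => φ x - c) x = fderiv ℝ φ x := fun x => fderiv_sub_const c
  simp_rw [hfd] at hc'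
  refine ⟨c, ?_⟩
  set J := ∫⁻ x in G.D, ‖fderiv ℝ φ x‖ₑ ^ 2
  have hgrad : ‖p.2.1‖ₑ ^ 2 = J := by
    rw [enorm_sq_Lp_two]
    refine lintegral_congr_ae ?_
    filter_upwards [h2] with x hx
    rw [hx, gradient, LinearIsometryEquiv.enorm_map]
  have hv : ‖p.1 - c • Lp.const 2 G.vol (1 : ℝ)‖ₑ ^ 2 ≤ C * J := by
    have : ‖p.1 - c • Lp.const 2 G.vol (1 : ℝ)‖ₑ ^ 2 = ∫⁻ x in G.D, ‖φ x - c‖ₑ ^ 2 := by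
      rw [enorm_sq_Lp_two]
      refine lintegral_congr_ae ?_
      filter_upwards [h1, Lp.coeFn_sub p.1 (c • Lp.const 2 G.vol (1 : ℝ)),
        Lp.coeFn_smul c (Lp.const 2 G.vol (1 : ℝ)), Lp.coeFn_const 2 G.vol (1 : ℝ)]
        with x k1 k2 k3 k4
      rw [k2, Pi.sub_apply, k3, Pi.smul_apply, k4, k1]
      simp
    rw [this]
    refine hc.trans (mul_le_mul_left ?_ _)
    rw [hC, add_comm 1 C₁, add_assoc]
    exact le_self_add
  have hτ : ‖p.2.2 - c • Lp.const 2 G.surf (1 : ℝ)‖ₑ ^ 2 ≤ C * J := by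
    have : ‖p.2.2 - c • Lp.const 2 G.surf (1 : ℝ)‖ₑ ^ 2 = ∫⁻ x, ‖φ x - c‖ₑ ^ 2 ∂G.surf := by
      rw [enorm_sq_Lp_two]
      refine lintegral_congr_ae ?_
      filter_upwards [h3, Lp.coeFn_sub p.2.2 (c • Lp.const 2 G.surf (1 : ℝ)),
        Lp.coeFn_smul c (Lp.const 2 G.surf (1 : ℝ)), Lp.coeFn_const 2 G.surf (1 : ℝ)]
        with x k1 k2 k3 k4
      rw [k2, Pi.sub_apply, k3, Pi.smul_apply, k4, k1]
      simp
    rw [this]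
    calc _ ≤ C₂ * (C₁ * J + J) := hc'.trans (by gcongr)
      _ = C₂ * (C₁ + 1) * J := by ring
      _ ≤ C * J := mul_le_mul_left le_add_self _
  have hg : ‖p.2.1 - c • (0 : Lp (EuclideanSpace ℝ (Fin d)) 2 G.vol)‖ₑ ^ 2 ≤ C * J := by
    rw [smul_zero, sub_zero, hgrad]
    refine le_mul_of_one_le_left' ?_
    rw [hC, add_assoc]
    exact le_self_add
  have key : ∀ {F : Type _} [SeminormedAddCommGroup F] (f : F), ‖f‖ₑ ^ 2 ≤ C * J →
      ‖f‖ ≤ √C.toReal * ‖p.2.1‖ := by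
    intro F _ f hf
    rw [← hgrad] at hf
    have := ENNReal.toReal_mono (by finiteness) hf
    rw [ENNReal.toReal_mul, ENNReal.toReal_pow, ENNReal.toReal_pow, toReal_enorm,
      toReal_enorm] at this
    rw [← Real.sqrt_sq (norm_nonneg p.2.1), ← Real.sqrt_mul ENNReal.toReal_nonneg]
    exact Real.le_sqrt_of_sq_le this
  exact max_le (key _ hv) (max_le (key _ hg) (key _ hτ))

/-- The mean value over the domain, as a functional on the triples. -/
def meanValue : G.TripleSpace →L[ℝ] ℝ :=
  (‖Lp.const 2 G.vol (1 : ℝ)‖ ^ 2)⁻¹ • (innerSL ℝ (Lp.const 2 G.vol (1 : ℝ))).comp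
    (ContinuousLinearMap.fst ℝ _ _)

theorem meanValue_oneTriple : G.meanValue G.oneTriple = 1 := by
  have h0 : Lp.const 2 G.vol (1 : ℝ) ≠ 0 := by
    intro h
    have hpos : 0 < volume G.D := G.isOpen_D.measure_pos volume G.isConnected_D.nonempty
    have hne : (ae G.vol).NeBot := by
      rw [ae_neBot, ← Measure.measure_univ_ne_zero, vol, Measure.restrict_apply_univ]
      exact hpos.ne'
    have hae := Lp.coeFn_const 2 G.vol (1 : ℝ)
    rw [h] at hae
    obtain ⟨x, h1, h2⟩ := (hae.and (Lp.coeFn_zero ℝ 2 G.vol)).exists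
    rw [h2] at h1
    exact zero_ne_one h1
  simp only [meanValue, oneTriple, smul_apply,
    ContinuousLinearMap.comp_apply, ContinuousLinearMap.coe_fst', innerSL_apply_apply,
    real_inner_self_eq_norm_sq, smul_eq_mul]
  exact inv_mul_cancel₀ (by simpa using h0)

/-- The Poincaré inequality, with trace, for functions of mean value `0`. -/
theorem exists_poincare : ∃ C : ℝ≥0, ∀ p ∈ G.smoothGraph.topologicalClosure,
    G.meanValue p = 0 → ‖p‖ ≤ C * ‖p.2.1‖ := by
  obtain ⟨C, hC, h⟩ := G.exists_poincare_smooth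
  set B := 1 + ‖G.meanValue‖ * ‖G.oneTriple‖
  have hsmooth : ∀ p ∈ G.smoothGraph, ‖p - G.meanValue p • G.oneTriple‖ ≤ B * C * ‖p.2.1‖ := by
    intro p hp
    obtain ⟨c, hc⟩ := h p hp
    -- Subtracting the mean value ignores constants, so the constant `c` of the smooth inequality,
    -- which depends on `p` in an uncontrolled way, may be replaced by the continuous functional
    -- `meanValue`. The inequality then passes to the closure.
    have hrw : p - G.meanValue p • G.oneTriple = (p - c • G.oneTriple) -
        G.meanValue (p - c • G.oneTriple) • G.oneTriple := by
      rw [map_sub, map_smul, meanValue_oneTriple, smul_eq_mul, mul_one, sub_smul]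
      abel
    calc ‖p - G.meanValue p • G.oneTriple‖
        ≤ ‖p - c • G.oneTriple‖ + ‖G.meanValue‖ * ‖p - c • G.oneTriple‖ * ‖G.oneTriple‖ := by
          rw [hrw]
          refine (norm_sub_le _ _).trans ?_
          rw [norm_smul]
          gcongr
          exact G.meanValue.le_opNorm _
      _ = B * ‖p - c • G.oneTriple‖ := by simp only [B]; ring
      _ ≤ B * (C * ‖p.2.1‖) := by gcongr
      _ = _ := by ring
  refine ⟨⟨B * C, by positivity⟩, fun p hp h0 => ?_⟩
  have hcl : IsClosed {p : G.TripleSpace |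
      ‖p - G.meanValue p • G.oneTriple‖ ≤ B * C * ‖p.2.1‖} :=
    isClosed_le (continuous_id.sub (G.meanValue.continuous.smul continuous_const)).norm
      (continuous_const.mul continuous_snd.fst.norm)
  have h1 : ‖p - G.meanValue p • G.oneTriple‖ ≤ B * C * ‖p.2.1‖ :=
    closure_minimal hsmooth hcl hp
  rwa [h0, zero_smul, sub_zero] at h1

/-- The target of `energyMap`. -/
abbrev EnergySpace : Type := WithLp 2 (Lp (EuclideanSpace ℝ (Fin d)) 2 G.vol ×
    PiLp 2 (fun k : Fin M => Lp ℝ 2 (G.surf.restrict (G.electrode k))))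

/-- The gradient and the restrictions of the trace to the electrodes. -/
def tripleEnergy : G.TripleSpace →L[ℝ] G.EnergySpace :=
  (WithLp.prodContinuousLinearEquiv 2 ℝ _ _).symm.toContinuousLinearMap ∘L
    ((ContinuousLinearMap.fst ℝ _ _ ∘L ContinuousLinearMap.snd ℝ _ _).prod
      ((PiLp.continuousLinearEquiv 2 ℝ _).symm.toContinuousLinearMap ∘L
        ContinuousLinearMap.pi fun k =>
          LpToLpRestrictCLM (EuclideanSpace ℝ (Fin d)) ℝ ℝ G.surf 2 (G.electrode k) ∘L
            ContinuousLinearMap.snd ℝ _ _ ∘L ContinuousLinearMap.snd ℝ _ _))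

/-- The constants on the electrodes. -/
def electrodeEnergy : (Fin M → ℝ) →ₗ[ℝ] G.EnergySpace :=
  (WithLp.linearEquiv 2 ℝ _).symm.toLinearMap ∘ₗ LinearMap.inr ℝ _ _ ∘ₗ
    (WithLp.linearEquiv 2 ℝ _).symm.toLinearMap ∘ₗ LinearMap.pi fun k =>
      Lp.constₗ 2 (G.surf.restrict (G.electrode k)) ℝ ∘ₗ LinearMap.proj k

theorem energyMap_mkH (p : G.PreH) : G.energyMap (G.mkH p) =
    G.tripleEnergy (p.1.1.1.1.1, p.1.1.1.1.2, p.1.1.2) - G.electrodeEnergy p.2 := by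
  refine (WithLp.ofLp_injective 2) (Prod.ext ?_ ((WithLp.ofLp_injective 2) (funext fun k => ?_)))
  · exact (sub_zero _).symm
  · rfl

/-- The triples of mean value `0` in the closure of the smooth triples. -/
def meanZero : Submodule ℝ G.TripleSpace :=
  G.smoothGraph.topologicalClosure ⊓ G.meanValue.ker

theorem sub_meanValue_mem_meanZero {w : G.TripleSpace}
    (hw : w ∈ G.smoothGraph.topologicalClosure) :
    w - G.meanValue w • G.oneTriple ∈ G.meanZero := by
  refine ⟨sub_mem hw (Submodule.smul_mem _ _
    (G.smoothGraph.le_topologicalClosure G.oneTriple_mem)), ?_⟩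
  have h : G.meanValue (w - G.meanValue w • G.oneTriple) = 0 := by
    rw [map_sub, map_smul, meanValue_oneTriple, smul_eq_mul, mul_one, sub_self]
  exact h

instance : CompleteSpace G.meanZero :=
  (G.smoothGraph.isClosed_topologicalClosure.inter G.meanValue.isClosed_ker).completeSpace_coe

/-- By Poincaré, the gradient component alone bounds a triple of mean value zero, so the map is
antilipschitz on a complete space. -/
theorem isClosed_map_meanZero :
    IsClosed (G.meanZero.map G.tripleEnergy.toLinearMap : Set G.EnergySpace) := by
  obtain ⟨C, hC⟩ := G.exists_poincare
  set T : G.meanZero →L[ℝ] G.EnergySpace := G.tripleEnergy ∘L G.meanZero.subtypeL with hT'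
  have hT : AntilipschitzWith C T := by
    refine T.antilipschitz_of_bound fun y => ?_
    refine (hC y.1 y.2.1 y.2.2).trans ?_
    gcongr
    have h := WithLp.prod_norm_sq_eq_of_L2 (T y)
    have h' : (T y).fst = y.1.2.1 := rfl
    rw [h'] at h
    refine abs_le_of_sq_le_sq' ?_ (norm_nonneg _) |>.2
    rw [h]
    exact le_add_of_nonneg_right (sq_nonneg _)
  have hrange : IsClosed (range T) := hT.isClosed_range T.uniformContinuous
  convert hrange using 1
  ext x
  simp [hT']

theorem tripleEnergy_oneTriple : G.tripleEnergy G.oneTriple = G.electrodeEnergy (fun _ => 1) := by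
  have h := G.energyMap_mkH (G.oneH1, fun _ => 1)
  have h0 : G.mkH (G.oneH1, fun _ => 1) = 0 :=
    (Submodule.Quotient.mk_eq_zero _).2 (Submodule.mem_span_singleton_self _)
  rw [h0, map_zero] at h
  exact (sub_eq_zero.1 h.symm)

/-- Removing the mean value from a function is compensated by changing the electrode constants,
because pairs of equal constants have zero energy. The range thus becomes a closed subspace plus a
finite-dimensional one. -/
theorem range_energyMap : LinearMap.range G.energyMap =
    G.meanZero.map G.tripleEnergy.toLinearMap ⊔ LinearMap.range G.electrodeEnergy := by
  apply le_antisymm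
  · rintro _ ⟨q, rfl⟩
    obtain ⟨p, rfl⟩ : ∃ p, G.mkH p = q := Submodule.mkQ_surjective _ q
    have hw := G.sub_meanValue_mem_meanZero (w := (p.1.1.1.1.1, p.1.1.1.1.2, p.1.1.2)) p.1.2
    rw [energyMap_mkH]
    generalize ((p.1.1.1.1.1, p.1.1.1.1.2, p.1.1.2) : G.TripleSpace) = w at hw
    refine Submodule.mem_sup.2 ⟨_, ⟨_, hw, rfl⟩, _,
      ⟨G.meanValue w • (fun _ => 1) - p.2, rfl⟩, ?_⟩
    have h1 : G.tripleEnergy (w - G.meanValue w • G.oneTriple) =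
        G.tripleEnergy w - G.meanValue w • G.electrodeEnergy (fun _ => 1) := by
      rw [map_sub, map_smul, tripleEnergy_oneTriple]
    have h2 : G.electrodeEnergy (G.meanValue w • (fun _ => 1) - p.2) =
        G.meanValue w • G.electrodeEnergy (fun _ => 1) - G.electrodeEnergy p.2 := by
      rw [map_sub, map_smul]
    exact (congrArg₂ (· + ·) h1 h2).trans (sub_add_sub_cancel _ _ _)
  · rw [sup_le_iff]
    constructor
    · rintro _ ⟨y, hy, rfl⟩
      refine ⟨G.mkH (G.traceOfMem hy.1, 0), ?_⟩
      rw [energyMap_mkH, map_zero, sub_zero]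
      rfl
    · rintro _ ⟨V, rfl⟩
      refine ⟨G.mkH (0, -V), ?_⟩
      rw [energyMap_mkH, map_neg, sub_neg_eq_add]
      exact (congrArg (· + _) (map_zero G.tripleEnergy)).trans (zero_add _)

theorem isClosed_range_energyMap :
    IsClosed (LinearMap.range G.energyMap : Set G.EnergySpace) := by
  rw [range_energyMap]
  exact Submodule.isClosed_sup_finiteDimensional _ _ G.isClosed_map_meanZero

end Geometry

/-! ### Parametric operator equations with coercive operators -/

theorem hasDerivAt_comp_iff_of_norm_eq {H K : Type*} [SeminormedAddCommGroup H]
    [NormedSpace ℝ H] [SeminormedAddCommGroup K] [NormedSpace ℝ K] (E : H →ₗ[ℝ] K)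
    (hE : ∀ x, ‖E x‖ = ‖x‖) {f : ℝ → H} {f' : H} {t : ℝ} :
    HasDerivAt (fun s => E (f s)) (E f') t ↔ HasDerivAt f f' t := by
  rw [hasDerivAt_iff_hasFDerivAt, hasDerivAt_iff_hasFDerivAt, hasFDerivAt_iff_isLittleO,
    hasFDerivAt_iff_isLittleO]
  rw [← Asymptotics.isLittleO_norm_left, ← Asymptotics.isLittleO_norm_left (f' := fun s => _ - _)]
  refine iff_of_eq (congrArg (fun g => g =o[𝓝 t] _) (funext fun s => ?_))
  rw [← hE]
  simp

/-- In a seminormed space derivatives are determined only up to vectors of norm zero, so `deriv f t`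
need not be `f'`; it is nevertheless a derivative. -/
theorem hasDerivAt_deriv_of_hasDerivAt {H : Type*} [SeminormedAddCommGroup H] [NormedSpace ℝ H]
    {f : ℝ → H} {f' : H} {t : ℝ} (h : HasDerivAt f f' t) : HasDerivAt f (deriv f t) t := by
  have h1 : DifferentiableAt ℝ f t := ⟨_, h.hasFDerivAt⟩
  have h2 := h1.hasFDerivAt
  have h3 : fderiv ℝ f t = ContinuousLinearMap.toSpanSingleton ℝ (deriv f t) := by
    ext
    simp [deriv]
  rw [h3] at h2
  exact h2

section Coercive

variable {H K : Type*} [SeminormedAddCommGroup H] [NormedSpace ℝ H] [NormedAddCommGroup K]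

/-- Partial derivatives, of all orders and in any order of differentiation, can be computed after
composition with a surjective linear isometry. -/
theorem map_foldr_partialDeriv [NormedSpace ℝ K] {E : H →ₗ[ℝ] K} (hE : ∀ x, ‖E x‖ = ‖x‖)
    (hsurj : Function.Surjective E) {u : (ℕ → ℝ) → H} {w : (ℕ →₀ ℕ) → (ℕ → ℝ) → K}
    (hw0 : ∀ y ∈ paramBox, E (u y) = w 0 y)
    (hw : ∀ ν j, ∀ y ∈ paramBox, HasDerivAt (fun t => w ν (Function.update y j t))
      (w (ν + Finsupp.single j 1) y) (y j)) (l : List ℕ) :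
    ∀ y ∈ paramBox, E (l.foldr partialDeriv u y) = w (Multiset.toFinsupp (l : Multiset ℕ)) y := by
  induction l with
  | nil => simpa using hw0
  | cons j l ih =>
    intro y hy
    have hν : Multiset.toFinsupp ((j :: l : List ℕ) : Multiset ℕ) =
        Multiset.toFinsupp (l : Multiset ℕ) + Finsupp.single j 1 := by
      rw [← Multiset.cons_coe, ← Multiset.singleton_add, map_add, Multiset.toFinsupp_singleton,
        add_comm]
    -- A preimage of the derivative in `K` shows that the iterated derivative is differentiable in
    -- `H`; the image of the value chosen by `deriv` is then fixed by uniqueness in `K`.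
    obtain ⟨q, hq⟩ := hsurj (w (Multiset.toFinsupp (l : Multiset ℕ) + Finsupp.single j 1) y)
    have h1 : HasDerivAt (fun t => E (l.foldr partialDeriv u (Function.update y j t)))
        (w (Multiset.toFinsupp (l : Multiset ℕ) + Finsupp.single j 1) y) (y j) := by
      refine (hw _ j y hy).congr_of_eventuallyEq ?_
      filter_upwards [eventually_update_mem_paramBox hy j] with t ht
      exact ih _ ht
    have h2 : HasDerivAt (fun t => l.foldr partialDeriv u (Function.update y j t)) q (y j) :=
      (hasDerivAt_comp_iff_of_norm_eq E hE).1 (hq.symm ▸ h1)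
    have h3 := (hasDerivAt_comp_iff_of_norm_eq E hE).2 (hasDerivAt_deriv_of_hasDerivAt h2)
    rw [hν]
    exact h3.unique h1

theorem map_mixedPartial [NormedSpace ℝ K] {E : H →ₗ[ℝ] K} (hE : ∀ x, ‖E x‖ = ‖x‖)
    (hsurj : Function.Surjective E) {u : (ℕ → ℝ) → H} {w : (ℕ →₀ ℕ) → (ℕ → ℝ) → K}
    (hw0 : ∀ y ∈ paramBox, E (u y) = w 0 y)
    (hw : ∀ ν j, ∀ y ∈ paramBox, HasDerivAt (fun t => w ν (Function.update y j t))
      (w (ν + Finsupp.single j 1) y) (y j)) (ν : ℕ →₀ ℕ) {y : ℕ → ℝ} (hy : y ∈ paramBox) :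
    E (mixedPartial ν u y) = w ν y := by
  have h := map_foldr_partialDeriv hE hsurj hw0 hw ((Finsupp.toMultiset ν).sort (· ≤ ·)) y hy
  rwa [Multiset.sort_eq, Finsupp.toMultiset_toFinsupp] at h

theorem hasAllPartials_of_map [NormedSpace ℝ K] {E : H →ₗ[ℝ] K} (hE : ∀ x, ‖E x‖ = ‖x‖)
    (hsurj : Function.Surjective E) {u : (ℕ → ℝ) → H} {w : (ℕ →₀ ℕ) → (ℕ → ℝ) → K}
    (hw0 : ∀ y ∈ paramBox, E (u y) = w 0 y)
    (hw : ∀ ν j, ∀ y ∈ paramBox, HasDerivAt (fun t => w ν (Function.update y j t))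
      (w (ν + Finsupp.single j 1) y) (y j)) : HasAllPartials u := by
  intro ν j y hy
  refine (hasDerivAt_comp_iff_of_norm_eq E hE).1 ?_
  rw [map_mixedPartial hE hsurj hw0 hw _ hy]
  refine (hw ν j y hy).congr_of_eventuallyEq ?_
  filter_upwards [eventually_update_mem_paramBox hy j] with t ht
  exact map_mixedPartial hE hsurj hw0 hw _ ht

variable [InnerProductSpace ℝ K]

theorem norm_le_of_coercive {T : K →L[ℝ] K} {c : ℝ}
    (hT : ∀ w, c * ‖w‖ ^ 2 ≤ ⟪T w, w⟫_ℝ) (w : K) : c * ‖w‖ ≤ ‖T w‖ := by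
  by_cases h : ‖w‖ = 0
  · rw [h, mul_zero]
    exact norm_nonneg _
  have hpos : 0 < ‖w‖ := lt_of_le_of_ne (norm_nonneg _) (Ne.symm h)
  refine le_of_mul_le_mul_right ?_ hpos
  rw [mul_assoc, ← sq]
  exact (hT w).trans (real_inner_le_norm _ _)

variable [CompleteSpace K]

/-- Lax–Milgram. -/
theorem exists_inverse_of_coercive {T : K →L[ℝ] K} {c : ℝ} (hc : 0 < c)
    (hT : ∀ w, c * ‖w‖ ^ 2 ≤ ⟪T w, w⟫_ℝ) : ∃ R : K →L[ℝ] K, T * R = 1 ∧ R * T = 1 := by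
  set B : K →L[ℝ] K →L[ℝ] ℝ := (innerSL ℝ).comp T
  have hB : IsCoercive B := ⟨c, hc, fun w => by
    rw [mul_assoc, ← sq]
    exact hT w⟩
  have heq : ∀ w, T w = hB.continuousLinearEquivOfBilin w := fun w =>
    hB.unique_continuousLinearEquivOfBilin fun v => rfl
  refine ⟨hB.continuousLinearEquivOfBilin.symm.toContinuousLinearMap, ?_, ?_⟩
  · ext w
    exact (heq _).trans (hB.continuousLinearEquivOfBilin.apply_symm_apply w)
  · ext w
    exact (congrArg _ (heq w)).trans (hB.continuousLinearEquivOfBilin.symm_apply_apply w)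

/-- The solution of an equation with a coercive operator that depends smoothly on the parameters
has partial derivatives of all orders, and they satisfy a recursive estimate. -/
theorem hasAllPartials_of_coercive {E : H →ₗ[ℝ] K} (hE : ∀ x, ‖E x‖ = ‖x‖)
    (hsurj : Function.Surjective E) {A : (ℕ →₀ ℕ) → (ℕ → ℝ) → K →L[ℝ] K}
    (hA : ∀ ν j, ∀ y ∈ paramBox, HasDerivAt (fun t => A ν (Function.update y j t))
      (A (ν + Finsupp.single j 1) y) (y j)) {c : ℝ} (hc : 0 < c)
    (hcoer : ∀ y ∈ paramBox, ∀ w, c * ‖w‖ ^ 2 ≤ ⟪A 0 y w, w⟫_ℝ) {u : (ℕ → ℝ) → H} {f : K}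
    (hu : ∀ y ∈ paramBox, A 0 y (E (u y)) = f) :
    HasAllPartials u ∧ ∀ ν : ℕ →₀ ℕ, ν ≠ 0 → ∀ y ∈ paramBox,
      c * ‖mixedPartial ν u y‖ ≤ ∑ m ∈ (Finset.Iic ν).filter (fun m => m ≠ 0),
        (multiChoose ν m : ℝ) * ‖A m y (E (mixedPartial (ν - m) u y))‖ := by
  have hinv : ∀ y, ∃ R : K →L[ℝ] K, y ∈ paramBox → A 0 y * R = 1 ∧ R * A 0 y = 1 := by
    intro y
    by_cases hy : y ∈ paramBox
    · obtain ⟨R, hR⟩ := exists_inverse_of_coercive hc (hcoer y hy)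
      exact ⟨R, fun _ => hR⟩
    · exact ⟨0, fun h => absurd h hy⟩
  choose R hR using hinv
  set w : (ℕ →₀ ℕ) → (ℕ → ℝ) → K := fun ν y => leibnizSolution (A · y) (R y) (E (u y)) ν
  have hw0 : ∀ y ∈ paramBox, E (u y) = w 0 y := fun y _ => (leibnizSolution_zero _ _ _).symm
  have hw : ∀ ν j, ∀ y ∈ paramBox, HasDerivAt (fun t => w ν (Function.update y j t))
      (w (ν + Finsupp.single j 1) y) (y j) := fun ν j y hy =>
    hasDerivAt_leibnizSolution hA (fun y hy => (hR y hy).1) (fun y hy => (hR y hy).2) hu ν j hy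
  refine ⟨hasAllPartials_of_map hE hsurj hw0 hw, fun ν hν y hy => ?_⟩
  have hmap : ∀ μ, E (mixedPartial μ u y) = w μ y := fun μ =>
    map_mixedPartial hE hsurj hw0 hw μ hy
  -- The Leibniz identity solved for its term `m = 0`. Coercivity is applied to it directly, and
  -- this is the source of the constant `c`.
  have hsum : A 0 y (w ν y) = -∑ m ∈ (Finset.Iic ν).filter (fun m => m ≠ 0),
      (multiChoose ν m : ℝ) • A m y (w (ν - m) y) := by
    have h := sum_leibnizSolution (A := (A · y)) (R := R y) (E (u y))
      (fun x => DFunLike.congr_fun (hR y hy).1 x) hν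
    rw [sum_Iic_eq_zero_add, multiChoose_zero_right, Nat.cast_one, one_smul, tsub_zero] at h
    exact eq_neg_of_add_eq_zero_left h
  rw [← hE, hmap]
  refine (norm_le_of_coercive (hcoer y hy) _).trans ?_
  rw [hsum, norm_neg]
  refine (norm_sum_le _ _).trans (Finset.sum_le_sum fun m _ => ?_)
  rw [norm_smul, Real.norm_natCast, hmap]

end Coercive

/-! ### Compression of the operators to a closed subspace -/

section Compression

variable {H K X V ι : Type*} [Fintype ι] {W : ι → Type*}
  [SeminormedAddCommGroup H] [NormedSpace ℝ H]
  [NormedAddCommGroup K] [InnerProductSpace ℝ K] [CompleteSpace K]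
  [NormedAddCommGroup X] [InnerProductSpace ℝ X] [CompleteSpace X]
  [NormedAddCommGroup V] [InnerProductSpace ℝ V] [CompleteSpace V]
  [∀ k, NormedAddCommGroup (W k)] [∀ k, InnerProductSpace ℝ (W k)] [∀ k, CompleteSpace (W k)]

/-- The compression `T ↦ g† T g` of operators. -/
def compression (g : K →L[ℝ] V) : (V →L[ℝ] V) →L[ℝ] K →L[ℝ] K :=
  ContinuousLinearMap.compL ℝ K V K (ContinuousLinearMap.adjoint g) ∘L
    (ContinuousLinearMap.compL ℝ K V V).flip g

theorem compression_apply (g : K →L[ℝ] V) (T : V →L[ℝ] V) (w : K) :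
    compression g T w = ContinuousLinearMap.adjoint g (T (g w)) := rfl

theorem inner_compression (g : K →L[ℝ] V) (T : V →L[ℝ] V) (w v : K) :
    ⟪compression g T w, v⟫_ℝ = ⟪T (g w), g v⟫_ℝ := by
  rw [compression_apply, ContinuousLinearMap.adjoint_inner_left]

theorem norm_compression_le {g : K →L[ℝ] V} (hg : ∀ w, ‖g w‖ ≤ ‖w‖) (T : V →L[ℝ] V) (w : K) :
    ‖compression g T w‖ ≤ ‖T (g w)‖ := by
  have h1 : ‖ContinuousLinearMap.adjoint g‖ ≤ 1 := by
    rw [LinearIsometryEquiv.norm_map]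
    exact g.opNorm_le_bound zero_le_one fun w => by
      rw [one_mul]
      exact hg w
  rw [compression_apply]
  simpa using ContinuousLinearMap.le_of_opNorm_le _ h1 (T (g w))

/-- A version of `hasAllPartials_of_coercive` for a variational equation on a space that is
isometric to a closed subspace of a Hilbert space. -/
theorem hasAllPartials_of_isClosed_range {E : H →ₗ[ℝ] X} (hE : ∀ x, ‖E x‖ = ‖x‖)
    (hclosed : IsClosed (LinearMap.range E : Set X)) {A : (ℕ →₀ ℕ) → (ℕ → ℝ) → X →L[ℝ] X}
    (hA : ∀ ν j, ∀ y ∈ paramBox, HasDerivAt (fun t => A ν (Function.update y j t))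
      (A (ν + Finsupp.single j 1) y) (y j)) {c : ℝ} (hc : 0 < c)
    (hcoer : ∀ y ∈ paramBox, ∀ w, c * ‖w‖ ^ 2 ≤ ⟪A 0 y w, w⟫_ℝ) {u : (ℕ → ℝ) → H} {f : H → ℝ}
    (hu : ∀ y ∈ paramBox, ∀ q, ⟪A 0 y (E (u y)), E q⟫_ℝ = f q) :
    HasAllPartials u ∧ ∀ ν : ℕ →₀ ℕ, ν ≠ 0 → ∀ y ∈ paramBox,
      c * ‖mixedPartial ν u y‖ ≤ ∑ m ∈ (Finset.Iic ν).filter (fun m => m ≠ 0),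
        (multiChoose ν m : ℝ) * ‖A m y (E (mixedPartial (ν - m) u y))‖ := by
  have : CompleteSpace (LinearMap.range E) := hclosed.completeSpace_coe
  set P : LinearMap.range E →L[ℝ] X := (LinearMap.range E).subtypeL with hP
  have hbox : (0 : ℕ → ℝ) ∈ paramBox := fun j => by norm_num
  have hin : ∀ y ∈ paramBox, ∀ q, ⟪compression P (A 0 y) (E.rangeRestrict (u y)),
      E.rangeRestrict q⟫_ℝ = f q := fun y hy q => by
    rw [inner_compression]
    exact hu y hy q
  obtain ⟨h1, h2⟩ := hasAllPartials_of_coercive (E := E.rangeRestrict) (fun x => hE x)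
    E.surjective_rangeRestrict (A := fun ν y => compression P (A ν y))
    (fun ν j y hy => (compression P).hasFDerivAt.comp_hasDerivAt (y j) (hA ν j y hy)) hc
    (fun y hy w => by
      rw [inner_compression]
      exact hcoer y hy (P w))
    -- The functional `f` is represented by the vector that the equation produces at the parameter
    -- `0`; at every other parameter the vector has the same inner products with the range.
    (f := compression P (A 0 0) (E.rangeRestrict (u 0))) (u := u) (fun y hy => by
      refine ext_inner_right ℝ fun v => ?_
      obtain ⟨q, rfl⟩ := E.surjective_rangeRestrict v
      rw [hin y hy, hin 0 hbox])
  refine ⟨h1, fun ν hν y hy => (h2 ν hν y hy).trans (Finset.sum_le_sum fun m _ => ?_)⟩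
  gcongr
  exact norm_compression_le (fun w => le_rfl) _ _

/-- The form splits into a part through `g` that carries the parameters and a fixed part through the
maps `r k`. Together they are coercive with constant `c`, while the derivatives involve the first
part only, so only `‖B m y‖` enters the estimate. -/
theorem hasAllPartials_of_isClosed_range_of_form {E : H →ₗ[ℝ] X} (hE : ∀ x, ‖E x‖ = ‖x‖)
    (hclosed : IsClosed (LinearMap.range E : Set X)) (g : X →L[ℝ] V) (r : ∀ k, X →L[ℝ] W k)
    (hnorm : ∀ x, ‖x‖ ^ 2 = ‖g x‖ ^ 2 + ∑ k, ‖r k x‖ ^ 2)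
    {B : (ℕ →₀ ℕ) → (ℕ → ℝ) → V →L[ℝ] V}
    (hB : ∀ ν j, ∀ y ∈ paramBox, HasDerivAt (fun t => B ν (Function.update y j t))
      (B (ν + Finsupp.single j 1) y) (y j)) {c : ℝ} (hc : 0 < c)
    (hcoer : ∀ y ∈ paramBox, ∀ v, c * ‖v‖ ^ 2 ≤ ⟪B 0 y v, v⟫_ℝ) {b : ι → ℝ} (hb : ∀ k, c ≤ b k)
    {u : (ℕ → ℝ) → H} {f : H → ℝ}
    (hu : ∀ y ∈ paramBox, ∀ q, ⟪B 0 y (g (E (u y))), g (E q)⟫_ℝ +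
      ∑ k, b k * ⟪r k (E (u y)), r k (E q)⟫_ℝ = f q) :
    HasAllPartials u ∧ ∀ ν : ℕ →₀ ℕ, ν ≠ 0 → ∀ y ∈ paramBox,
      c * ‖mixedPartial ν u y‖ ≤ ∑ m ∈ (Finset.Iic ν).filter (fun m => m ≠ 0),
        (multiChoose ν m : ℝ) * (‖B m y‖ * ‖mixedPartial (ν - m) u y‖) := by
  have hg : ∀ x, ‖g x‖ ≤ ‖x‖ := fun x => by
    refine (abs_le_of_sq_le_sq' ?_ (norm_nonneg _)).2
    rw [hnorm]
    exact le_add_of_nonneg_right (Finset.sum_nonneg fun _ _ => sq_nonneg _)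
  set J : X →L[ℝ] X := ∑ k, b k • compression (r k) (ContinuousLinearMap.id ℝ (W k)) with hJ
  have hJin : ∀ w v, ⟪J w, v⟫_ℝ = ∑ k, b k * ⟪r k w, r k v⟫_ℝ := fun w v => by
    rw [hJ, sum_apply, sum_inner]
    refine Finset.sum_congr rfl fun k _ => ?_
    rw [smul_apply, real_inner_smul_left, inner_compression]
    rfl
  -- The fixed part `J` is constant in the parameters and is therefore present only for `ν = 0`.
  set A : (ℕ →₀ ℕ) → (ℕ → ℝ) → X →L[ℝ] X := fun ν y =>
    compression g (B ν y) + if ν = 0 then J else 0 with hA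
  have hAne : ∀ ν ≠ 0, ∀ y, A ν y = compression g (B ν y) := fun ν hν y => by
    simp only [hA]
    rw [if_neg hν, add_zero]
  have hA0 : ∀ y w v, ⟪A 0 y w, v⟫_ℝ = ⟪B 0 y (g w), g v⟫_ℝ + ∑ k, b k * ⟪r k w, r k v⟫_ℝ :=
    fun y w v => by
      simp only [hA]
      rw [if_pos trivial, add_apply, inner_add_left, inner_compression, hJin]
  obtain ⟨h1, h2⟩ := hasAllPartials_of_isClosed_range hE hclosed (A := A) (fun ν j y hy => by
      have hne : ν + Finsupp.single j 1 ≠ 0 := fun h => by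
        have := DFunLike.congr_fun h j
        simp at this
      rw [hAne _ hne]
      exact ((compression g).hasFDerivAt.comp_hasDerivAt (y j) (hB ν j y hy)).add_const _) hc
    (fun y hy w => by
      rw [hA0, hnorm, mul_add, Finset.mul_sum]
      refine add_le_add (hcoer y hy _) (Finset.sum_le_sum fun k _ => ?_)
      rw [real_inner_self_eq_norm_sq]
      exact mul_le_mul_of_nonneg_right (hb k) (sq_nonneg _))
    (f := f) (u := u) (fun y hy q => (hA0 y _ _).trans (hu y hy q))
  refine ⟨h1, fun ν hν y hy => (h2 ν hν y hy).trans (Finset.sum_le_sum fun m hm => ?_)⟩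
  rw [hAne m (Finset.mem_filter.1 hm).2]
  gcongr
  refine (norm_compression_le hg _ _).trans (((B m y).le_opNorm _).trans ?_)
  gcongr
  exact (hg _).trans_eq (hE _)

end Compression

/-! ### The operators of the complete electrode model -/

namespace Geometry

variable {d M : ℕ} (G : Geometry d M)

/-- The gradient, on the target of `energyMap`. -/
def gradL : G.EnergySpace →L[ℝ] Lp (EuclideanSpace ℝ (Fin d)) 2 G.vol :=
  ContinuousLinearMap.fst ℝ _ _ ∘L
    (WithLp.prodContinuousLinearEquiv 2 ℝ _ _).toContinuousLinearMap

/-- The electrode differences, on the target of `energyMap`. -/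
def jumpL (k : Fin M) : G.EnergySpace →L[ℝ] Lp ℝ 2 (G.surf.restrict (G.electrode k)) :=
  ContinuousLinearMap.proj k ∘L
    (PiLp.continuousLinearEquiv 2 ℝ
      (fun k : Fin M => Lp ℝ 2 (G.surf.restrict (G.electrode k)))).toContinuousLinearMap ∘L
    ContinuousLinearMap.snd ℝ _ _ ∘L
    (WithLp.prodContinuousLinearEquiv 2 ℝ _ _).toContinuousLinearMap

theorem norm_energyMap (q : G.H) : ‖G.energyMap q‖ = ‖q‖ := rfl

theorem norm_sq_energySpace (w : G.EnergySpace) :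
    ‖w‖ ^ 2 = ‖G.gradL w‖ ^ 2 + ∑ k, ‖G.jumpL k w‖ ^ 2 := by
  have h := WithLp.prod_norm_sq_eq_of_L2 w
  rw [PiLp.norm_sq_eq_of_L2] at h
  exact h

/-- Multiplication of a square integrable vector field by an essentially bounded function. -/
def mulL : Lp ℝ ⊤ G.vol →L[ℝ] Lp (EuclideanSpace ℝ (Fin d)) 2 G.vol →L[ℝ]
    Lp (EuclideanSpace ℝ (Fin d)) 2 G.vol :=
  (ContinuousLinearMap.lsmul ℝ ℝ).holderL G.vol ⊤ 2 2

theorem mulL_coeFn (α : Lp ℝ ⊤ G.vol) (g : Lp (EuclideanSpace ℝ (Fin d)) 2 G.vol) :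
    G.mulL α g =ᵐ[G.vol] fun x => α x • g x :=
  (ContinuousLinearMap.lsmul ℝ ℝ).coeFn_holder α g

theorem norm_mulL_le (α : Lp ℝ ⊤ G.vol) (g : Lp (EuclideanSpace ℝ (Fin d)) 2 G.vol) :
    ‖G.mulL α g‖ ≤ ‖α‖ * ‖g‖ := by
  refine ((ContinuousLinearMap.lsmul ℝ ℝ).norm_holder_apply_apply_le α g).trans ?_
  rw [mul_assoc]
  exact mul_le_of_le_one_left (by positivity) ContinuousLinearMap.opNorm_lsmul_le

theorem inner_mulL (α : Lp ℝ ⊤ G.vol) (g h : Lp (EuclideanSpace ℝ (Fin d)) 2 G.vol) :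
    ⟪G.mulL α g, h⟫_ℝ = ∫ x in G.D, α x * ⟪g x, h x⟫_ℝ := by
  rw [L2.inner_def]
  refine integral_congr_ae ?_
  filter_upwards [G.mulL_coeFn α g] with x hx
  rw [hx, real_inner_smul_left]

theorem mul_norm_sq_le_inner_mulL {α : Lp ℝ ⊤ G.vol} {c : ℝ} (hα : ∀ᵐ x ∂G.vol, c ≤ α x)
    (g : Lp (EuclideanSpace ℝ (Fin d)) 2 G.vol) : c * ‖g‖ ^ 2 ≤ ⟪G.mulL α g, g⟫_ℝ := by
  rw [← real_inner_self_eq_norm_sq, L2.inner_def, L2.inner_def, ← integral_const_mul]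
  refine integral_mono_ae ((L2.integrable_inner g g).const_mul c)
    (L2.integrable_inner (G.mulL α g) g) ?_
  filter_upwards [hα, G.mulL_coeFn α g] with x h1 h2
  rw [h2, real_inner_smul_left]
  exact mul_le_mul_of_nonneg_right h1 real_inner_self_nonneg

namespace Conductivity

variable {G} {a : EuclideanSpace ℝ (Fin d) → (ℕ → ℝ) → ℝ} {C σ : ℝ}
  {ρ : ℕ → ℝ} {amin amax : ℝ}

theorem hasDerivAt_mulL_coeff (ha : G.Conductivity a C σ ρ amin amax)
    (ν : ℕ →₀ ℕ) (j : ℕ) {y : ℕ → ℝ} (hy : y ∈ paramBox) :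
    HasDerivAt (fun t => G.mulL (G.coeff a ν (Function.update y j t)))
      (G.mulL (G.coeff a (ν + Finsupp.single j 1) y)) (y j) :=
  G.mulL.hasFDerivAt.comp_hasDerivAt (y j) (ha.hasDerivAt_coeff ν j hy)

theorem coeff_zero_coeFn (ha : G.Conductivity a C σ ρ amin amax) {y : ℕ → ℝ}
    (hy : y ∈ paramBox) : G.coeff a 0 y =ᵐ[G.vol] fun x => a x y := by
  simpa only [mixedPartial_zero] using ha.coeff_coeFn 0 hy

/-- Puts the bilinear form in the split shape: multiplication by the conductivity on gradients, and
weights `1 / z m` on electrode differences. -/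
theorem bilin_eq (ha : G.Conductivity a C σ ρ amin amax) (z : Fin M → ℝ) {y : ℕ → ℝ}
    (hy : y ∈ paramBox) (w v : G.H) :
    ⟪G.mulL (G.coeff a 0 y) (G.grad w), G.grad v⟫_ℝ +
      ∑ m, 1 / z m * ⟪G.jump m w, G.jump m v⟫_ℝ = G.bilin (fun x => a x y) z w v := by
  rw [inner_mulL, bilin]
  congr 1
  · refine integral_congr_ae ?_
    filter_upwards [ha.coeff_zero_coeFn hy] with x hx
    rw [hx]
  · refine Finset.sum_congr rfl fun m _ => ?_
    rw [L2.inner_def]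
    congr 1
    refine integral_congr_ae (.of_forall fun x => ?_)
    simp [mul_comm]

theorem coercive_mulL_coeff (ha : G.Conductivity a C σ ρ amin amax) {y : ℕ → ℝ}
    (hy : y ∈ paramBox) (g : Lp (EuclideanSpace ℝ (Fin d)) 2 G.vol) :
    amin * ‖g‖ ^ 2 ≤ ⟪G.mulL (G.coeff a 0 y) g, g⟫_ℝ := by
  refine G.mul_norm_sq_le_inner_mulL ?_ g
  filter_upwards [ha.coeff_zero_coeFn hy, G.ae_mem_D] with x h1 h2
  rw [h1]
  exact (ha.bounds x h2 y hy).1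

theorem opNorm_mulL_coeff_le (ha : G.Conductivity a C σ ρ amin amax) (ν : ℕ →₀ ℕ) {y : ℕ → ℝ}
    (hy : y ∈ paramBox) : ‖G.mulL (G.coeff a ν y)‖ ≤
      C * (Nat.factorial ν.degree : ℝ) ^ σ * multiPow ρ ν :=
  (ContinuousLinearMap.opNorm_le_bound _ (norm_nonneg _) (G.norm_mulL_le _)).trans
    (ha.norm_coeff_le ν hy)

end Conductivity

end Geometry

end CEM

end

/-! ### The recursive estimate for the electrode model -/

theorem mainTheorem7 {d M : ℕ} (hd : d ∈ ({1, 2, 3} : Set ℕ)) (hM : 2 ≤ M)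
    (G : CEM.Geometry d M)
    (a : EuclideanSpace ℝ (Fin d) → (ℕ → ℝ) → ℝ) (C σ : ℝ) (ρ : ℕ → ℝ) (amin amax : ℝ)
    (ha : G.Conductivity a C σ ρ amin amax)
    (z : Fin M → ℝ) (ςminus ςplus : ℝ) (hς : 0 < ςminus)
    (hz : ∀ m, ςminus ≤ z m ∧ z m ≤ ςplus)
    (I : Fin M → ℝ) (hI : ∑ m, I m = 0)
    (u : (ℕ → ℝ) → G.H)
    (hu : ∀ y ∈ CEM.paramBox, G.IsSolution (fun x => a x y) z I (u y)) :
    CEM.HasAllPartials u ∧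
    ∀ ν : ℕ →₀ ℕ, ν ≠ 0 → ∀ y ∈ CEM.paramBox,
      ‖CEM.mixedPartial ν u y‖ ≤
        C / min amin ςplus⁻¹ *
          ∑ m ∈ (Finset.Iic ν).filter (fun m => m ≠ 0),
            (CEM.multiChoose ν m : ℝ) * (Nat.factorial m.degree : ℝ) ^ σ * CEM.multiPow ρ m *
              ‖CEM.mixedPartial (ν - m) u y‖ := by
  have hz' : ∀ m, 0 < z m ∧ z m ≤ ςplus := fun m => ⟨hς.trans_le (hz m).1, (hz m).2⟩
  have hςplus : 0 < ςplus := by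
    have m : Fin M := ⟨0, by omega⟩
    exact (hz' m).1.trans_le (hz' m).2
  have hc : 0 < min amin ςplus⁻¹ := lt_min ha.amin_pos (inv_pos.2 hςplus)
  -- The load depends on the test pair only, so the form at the parameter `0` can stand for it as a
  -- function on the quotient `𝓗`.
  have hsol : ∀ y ∈ CEM.paramBox, ∀ q, G.bilin (fun x => a x y) z (u y) q =
      G.bilin (fun x => a x 0) z (u 0) q := by
    intro y hy q
    obtain ⟨p, rfl⟩ : ∃ p, G.mkH p = q := Submodule.mkQ_surjective _ q
    rw [hu y hy p, hu 0 (fun j => by norm_num) p]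
  obtain ⟨hpart, hest⟩ := CEM.hasAllPartials_of_isClosed_range_of_form G.norm_energyMap
    G.isClosed_range_energyMap G.gradL G.jumpL G.norm_sq_energySpace
    (B := fun ν y => G.mulL (G.coeff a ν y))
    (fun ν j y hy => ha.hasDerivAt_mulL_coeff ν j hy) hc
    (fun y hy g => (mul_le_mul_of_nonneg_right (min_le_left _ _) (sq_nonneg _)).trans
      (ha.coercive_mulL_coeff hy g))
    (b := fun m => 1 / z m)
    (fun m => (min_le_right _ _).trans ((inv_anti₀ (hz' m).1 (hz' m).2).trans_eq (one_div _).symm))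
    (u := u) (f := G.bilin (fun x => a x 0) z (u 0))
    (fun y hy q => (ha.bilin_eq z hy (u y) q).trans (hsol y hy q))
  refine ⟨hpart, fun ν hν y hy => ?_⟩
  rw [div_mul_eq_mul_div, le_div_iff₀' hc, Finset.mul_sum]
  refine (hest ν hν y hy).trans (Finset.sum_le_sum fun m hm => ?_)
  calc (CEM.multiChoose ν m : ℝ) *
        (‖G.mulL (G.coeff a m y)‖ * ‖CEM.mixedPartial (ν - m) u y‖)
      ≤ (CEM.multiChoose ν m : ℝ) * ((C * (Nat.factorial m.degree : ℝ) ^ σ * CEM.multiPow ρ m) *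
          ‖CEM.mixedPartial (ν - m) u y‖) := by
        gcongr
        exact ha.opNorm_mulL_coeff_le m hy
    _ = _ := by ring
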